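/- Let $M$ be an oriented matroid on a finite set $E$ with set of covectors $\mathcal{L}\subseteq\{+,-,0\}^E$, let $\underline{M}$ be its underlying matroid (whose flats are the zero sets of the covectors), and let $r$ be its rank. Let $N$ be an oriented matroid on $E\cup\{g\}$, $g\notin E$, with set of covectors $\mathcal{L}_g$, such that deleting $g$ from $N$ gives $M$. Assume that $g$ is neither a loop nor a coloop of $N$, and that $g$ is generic: $g$ is not in the closure, in $N$, of any $A\subseteq E$ with $r(A)<r$. Order sign vectors by $X\le Y$ if every entry of $X$ is $0$ or equal to the corresponding entry of $Y$; a tope is a maximal covector. Let $\mathcal{L}_g^{++}$ be the set of all $X\in\mathcal{L}_g$ with $X_g=+$ such that every nonzero $Y\in\mathcal{L}_g$ with $Y\le X$ has $Y_g=+$. Let $B^{++}\subseteq\{+,-,0\}^E$ be the set of restrictions to $E$ of the maximal elements of $\mathcal{L}_g^{++}$ (the bounded topes of $M$ with respect to $g$). For a weight $\omega\in\mathbb{R}^E$ let $\emptyset=F_0\subset F_1\subset\dots\subset F_{k+1}=E$ be the flag of sublevel sets of $\omega$, so that $\omega$ is constant on each $F_i\setminus F_{i-1}$ and increases with $i$.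 Let $\underline{M}_\omega$ be the matroid whose bases are the bases of $\underline{M}$ of minimum $\omega$-weight, and let $M_\omega=\bigoplus_{i}(M|F_i)/F_{i-1}$, an orientation of $\underline{M}_\omega$. On the sphere $S=\{\omega\in\mathbb{R}^E:\sum_e\omega_e=0,\ \sum_e\omega_e^2=1\}$ define the Bergman complex $\mathcal{B}(\underline{M})=\{\omega\in S:\underline{M}_\omega\text{ has no loops}\}$ and the positive Bergman complex $\mathcal{B}^+(M)=\{\omega\in S: M_\omega\text{ is acyclic}\}$, where acyclic means that the all-positive sign vector is a covector. For a tope $T$ of $M$ let ${}_TM$ be the reorientation of $M$ obtained by reversing the signs of the elements $e$ with $T_e=-$. Finally let $\mu(M)$ be the value $\mu(\hat 0,\hat 1)$ of the Möbius function of the lattice of flats of $\underline{M}$. Then every element of $B^{++}$ is a tope of $M$, the number of elements of $B^{++}$ is exactly $|\mu(M)|$, and the corresponding positive Bergman complexes cover the Bergman complex: $$\bigcup_{T\in B^{++}}\mathcal{B}^+({}_TM)=\mathcal{B}(\underline{M}).$$ -/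

import Mathlib

/-- The composition `X ∘ Y` of two sign vectors: `X` where `X` is nonzero, `Y` elsewhere. -/
def signComp {E : Type*} (X Y : E → SignType) : E → SignType :=
  fun e => if X e = 0 then Y e else X e

/-- `e` separates `X` and `Y`: the two signs at `e` are nonzero and opposite. -/
def SignSep {E : Type*} (X Y : E → SignType) (e : E) : Prop :=
  X e ≠ 0 ∧ X e = -Y e

/-- The face order on sign vectors: `X` arises from `Y` by replacing some entries by `0`.
(This is not the pointwise order induced by `-1 < 0 < 1`.) -/
def SignFace {E : Type*} (X Y : E → SignType) : Prop :=
  ∀ e, X e = 0 ∨ X e = Y e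

/-- Oriented matroids on the ground set `E`, presented by the covector axioms. -/
structure OrientedMatroid (E : Type*) where
  covectors : Set (E → SignType)
  zero_mem : 0 ∈ covectors
  neg_mem : ∀ X ∈ covectors, -X ∈ covectors
  comp_mem : ∀ X ∈ covectors, ∀ Y ∈ covectors, signComp X Y ∈ covectors
  elim : ∀ X ∈ covectors, ∀ Y ∈ covectors, ∀ e, SignSep X Y e →
    ∃ Z ∈ covectors, Z e = 0 ∧ ∀ f, ¬ SignSep X Y f → Z f = signComp X Y f

namespace OrientedMatroid

variable {E : Type*}

/-- A set meets the support of every nonzero covector. -/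
def Transversal (M : OrientedMatroid E) (B : Set E) : Prop :=
  ∀ X ∈ M.covectors, (∀ e ∈ B, X e = 0) → X = 0

lemma exists_elim (M : OrientedMatroid E) {X Y : E → SignType} (hX : X ∈ M.covectors)
    (hY : Y ∈ M.covectors) {e : E} (hXe : X e ≠ 0) (hYe : Y e ≠ 0) :
    ∃ Z ∈ M.covectors, Z e = 0 ∧ ∀ f, (X f = 0 ∨ Y f = 0) → (Z f = 0 ↔ X f = 0 ∧ Y f = 0) := by
  have key : ∀ Y ∈ M.covectors, X e = - Y e →
      ∃ Z ∈ M.covectors, Z e = 0 ∧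
        ∀ f, (X f = 0 ∨ Y f = 0) → (Z f = 0 ↔ X f = 0 ∧ Y f = 0) := by
    intro Y hY h
    obtain ⟨Z, hZ, hZe, hZf⟩ := M.elim X hX Y hY e ⟨hXe, h⟩
    refine ⟨Z, hZ, hZe, fun f hf => ?_⟩
    have hns : ¬ SignSep X Y f := by
      rintro ⟨h1, h2⟩
      rcases hf with hf | hf
      · exact h1 hf
      · rw [hf] at h2
        exact h1 (by simpa using h2)
    rw [hZf f hns]
    unfold signComp
    split_ifs with h0 <;> simp [h0]
  by_cases h : X e = - Y e
  · exact key Y hY h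
  · obtain ⟨Z, hZ, hZe, hZf⟩ := key (-Y) (M.neg_mem Y hY) (by
      simp only [Pi.neg_apply, neg_neg]
      revert hXe hYe h
      generalize X e = a
      generalize Y e = b
      revert a b
      decide)
    refine ⟨Z, hZ, hZe, fun f hf => ?_⟩
    have := hZf f (by simpa using hf)
    simpa using this

lemma minimal_transversal_iff (M : OrientedMatroid E) (B : Set E) :
    Minimal M.Transversal B ↔ M.Transversal B ∧
      ∀ e ∈ B, ∃ X ∈ M.covectors, X e ≠ 0 ∧ ∀ f ∈ B, f ≠ e → X f = 0 := by
  constructor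
  · intro h
    refine ⟨h.prop, fun e he => ?_⟩
    by_contra! hc
    have : M.Transversal (B \ {e}) := by
      intro X hX h0
      refine h.prop X hX fun f hf => ?_
      by_cases hfe : f = e
      · by_contra h1
        subst hfe
        obtain ⟨f', hf', hne, h2⟩ := hc X hX h1
        exact h2 (h0 f' ⟨hf', hne⟩)
      · exact h0 f ⟨hf, hfe⟩
    exact (h.le_of_le this Set.sdiff_subset he).2 rfl
  · rintro ⟨hB, h⟩
    refine ⟨hB, fun C hC hCB e he => ?_⟩
    by_contra heC
    obtain ⟨X, hX, hXe, hX0⟩ := h e he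
    exact hXe (congrFun (hC X hX fun f hf => hX0 f (hCB hf) (by rintro rfl; exact heC hf)) e)

lemma exists_minimal_transversal [Finite E] (M : OrientedMatroid E) :
    ∃ B, Minimal M.Transversal B := by
  have h : M.Transversal Set.univ := fun X _ h => funext fun e => h e trivial
  obtain ⟨B, -, hB⟩ := (Set.toFinite {B | M.Transversal B}).exists_le_minimal h
  exact ⟨B, hB⟩

lemma exchange (M : OrientedMatroid E) : Matroid.ExchangeProperty (Minimal M.Transversal) := by
  intro B C hB hC e he
  rw [minimal_transversal_iff] at hB hC
  obtain ⟨X, hX, hXe, hX0⟩ := hB.2 e he.1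
  have : ∃ f ∈ C, X f ≠ 0 := by
    by_contra! h
    exact hXe (congrFun (hC.1 X hX h) e)
  obtain ⟨f, hfC, hXf⟩ := this
  have hfe : f ≠ e := by rintro rfl; exact he.2 hfC
  have hfB : f ∉ B := fun hfB => hXf (hX0 f hfB hfe)
  refine ⟨f, ⟨hfC, hfB⟩, (M.minimal_transversal_iff _).2 ⟨?_, ?_⟩⟩
  · intro Y hY hY0
    by_cases hYe : Y e = 0
    · refine hB.1 Y hY fun b hb => ?_
      by_cases hbe : b = e
      · rw [hbe, hYe]
      · exact hY0 b (Or.inr ⟨hb, hbe⟩)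
    · exfalso
      obtain ⟨Z, hZ, hZe, hZf⟩ := M.exists_elim hX hY hXe hYe
      have hZ0 : Z = 0 := by
        refine hB.1 Z hZ fun b hb => ?_
        by_cases hbe : b = e
        · rw [hbe, hZe]
        · exact (hZf b (Or.inl (hX0 b hb hbe))).2 ⟨hX0 b hb hbe, hY0 b (Or.inr ⟨hb, hbe⟩)⟩
      exact hXf ((hZf f (Or.inr (hY0 f (Or.inl rfl)))).1 (congrFun hZ0 f)).1
  · rintro b (rfl | ⟨hb, hbe⟩)
    · refine ⟨X, hX, hXf, ?_⟩
      rintro c (rfl | ⟨hc, hce⟩) hcb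
      · exact absurd rfl hcb
      · exact hX0 c hc hce
    · have hbe : b ≠ e := hbe
      obtain ⟨Y, hY, hYb, hY0⟩ := hB.2 b hb
      by_cases hYf : Y f = 0
      · refine ⟨Y, hY, hYb, ?_⟩
        rintro c (rfl | ⟨hc, hce⟩) hcb
        · exact hYf
        · exact hY0 c hc hcb
      · obtain ⟨Z, hZ, hZf, hZ0⟩ := M.exists_elim hX hY hXf hYf
        have hXb := hX0 b hb hbe
        refine ⟨Z, hZ, fun h => hYb ((hZ0 b (Or.inl hXb)).1 h).2, ?_⟩
        rintro c (rfl | ⟨hc, hce⟩) hcb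
        · exact hZf
        · exact (hZ0 c (Or.inl (hX0 c hc hce))).2 ⟨hX0 c hc hce, hY0 c hc hcb⟩

/-- The underlying matroid: its bases are the minimal sets meeting the support of every nonzero
covector. Its flats are the zero sets of the covectors, see `isFlat_matroid_iff`. -/
def matroid [Finite E] (M : OrientedMatroid E) : Matroid E :=
  Matroid.ofIsBaseOfFinite Set.finite_univ (Minimal M.Transversal)
    M.exists_minimal_transversal M.exchange fun _ _ => Set.subset_univ _

lemma indep_insert_aux (M : OrientedMatroid E) {I : Set E}
    (hI : ∀ e ∈ I, ∃ X ∈ M.covectors, X e ≠ 0 ∧ ∀ f ∈ I, f ≠ e → X f = 0) {X : E → SignType}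
    (hX : X ∈ M.covectors) (hXI : ∀ f ∈ I, X f = 0) {e : E} (hXe : X e ≠ 0) :
    ∀ b ∈ insert e I, ∃ Y ∈ M.covectors, Y b ≠ 0 ∧ ∀ f ∈ insert e I, f ≠ b → Y f = 0 := by
  rintro b (rfl | hb)
  · refine ⟨X, hX, hXe, ?_⟩
    rintro c (rfl | hc) hcb
    · exact absurd rfl hcb
    · exact hXI c hc
  · obtain ⟨Y, hY, hYb, hY0⟩ := hI b hb
    by_cases hYe : Y e = 0
    · refine ⟨Y, hY, hYb, ?_⟩
      rintro c (rfl | hc) hcb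
      · exact hYe
      · exact hY0 c hc hcb
    · obtain ⟨Z, hZ, hZe, hZ0⟩ := M.exists_elim hX hY hXe hYe
      refine ⟨Z, hZ, fun h => hYb ((hZ0 b (Or.inl (hXI b hb))).1 h).2, ?_⟩
      rintro c (rfl | hc) hcb
      · exact hZe
      · exact (hZ0 c (Or.inl (hXI c hc))).2 ⟨hXI c hc, hY0 c hc hcb⟩

lemma indep_matroid_iff [Finite E] (M : OrientedMatroid E) (I : Set E) :
    M.matroid.Indep I ↔ ∀ e ∈ I, ∃ X ∈ M.covectors, X e ≠ 0 ∧ ∀ f ∈ I, f ≠ e → X f = 0 := by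
  constructor
  · intro hI e he
    obtain ⟨B, hB, hIB⟩ := hI.exists_isBase_superset
    obtain ⟨X, hX, hXe, hX0⟩ := ((M.minimal_transversal_iff B).1 hB).2 e (hIB he)
    exact ⟨X, hX, hXe, fun f hf => hX0 f (hIB hf)⟩
  · intro hI
    obtain ⟨J, hIJ, hJ⟩ := (Set.toFinite {I : Set E | ∀ e ∈ I, ∃ X ∈ M.covectors,
      X e ≠ 0 ∧ ∀ f ∈ I, f ≠ e → X f = 0}).exists_le_maximal hI
    have hB : M.matroid.IsBase J := (M.minimal_transversal_iff J).2 ⟨fun X hX hX0 => by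
      by_contra hne
      obtain ⟨e, he⟩ := Function.ne_iff.1 hne
      exact he (hX0 e (hJ.le_of_ge (M.indep_insert_aux hJ.prop hX hX0 he)
        (Set.subset_insert e J) (Set.mem_insert e J))), hJ.prop⟩
    exact hB.indep.subset hIJ

lemma mem_closure_matroid_iff [Finite E] (M : OrientedMatroid E) (A : Set E) (e : E) :
    e ∈ M.matroid.closure A ↔ ∀ X ∈ M.covectors, (∀ a ∈ A, X a = 0) → X e = 0 := by
  obtain ⟨I, hI⟩ := M.matroid.exists_isBasis A (Set.subset_univ A)
  have hIi := (M.indep_matroid_iff I).1 hI.indep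
  rw [← hI.closure_eq_closure, hI.indep.mem_closure_iff']
  constructor
  · rintro ⟨-, h⟩ X hX hXA
    by_contra hXe
    have heI := h ((M.indep_matroid_iff _).2
      (M.indep_insert_aux hIi hX (fun f hf => hXA f (hI.subset hf)) hXe))
    exact hXe (hXA e (hI.subset heI))
  · intro h
    refine ⟨Set.mem_univ e, fun hins => ?_⟩
    by_contra heI
    obtain ⟨X, hX, hXe, hX0⟩ := (M.indep_matroid_iff _).1 hins e (Set.mem_insert e I)
    have hXI : ∀ f ∈ I, X f = 0 := fun f hf =>
      hX0 f (Set.mem_insert_of_mem e hf) (by rintro rfl; exact heI hf)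
    refine hXe (h X hX fun a ha => ?_)
    by_contra hXa
    exact hXa (hXI a (hI.mem_of_insert_indep ha
      ((M.indep_matroid_iff _).2 (M.indep_insert_aux hIi hX hXI hXa))))

lemma isFlat_matroid_iff [Finite E] (M : OrientedMatroid E) (F : Set E) :
    M.matroid.IsFlat F ↔ ∃ X ∈ M.covectors, F = {e | X e = 0} := by
  rw [Matroid.isFlat_iff_closure_eq]
  constructor
  · intro hF
    obtain ⟨Z, -, hZ⟩ := (Set.toFinite {Z : Set E | ∃ X ∈ M.covectors,
      (∀ e ∈ F, X e = 0) ∧ Z = {e | X e = 0}}).exists_le_minimal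
      ⟨0, M.zero_mem, fun _ _ => rfl, rfl⟩
    obtain ⟨X, hX, hXF, rfl⟩ := hZ.prop
    refine ⟨X, hX, Set.Subset.antisymm hXF fun e he => ?_⟩
    rw [← hF, mem_closure_matroid_iff]
    intro Y hY hYF
    have := hZ.le_of_le (y := {e | signComp X Y e = 0})
      ⟨signComp X Y, M.comp_mem X hX Y hY, fun f hf => by simp [signComp, hXF f hf, hYF f hf], rfl⟩
      (fun f hf => by
        by_contra h
        exact h (by simpa [signComp, show X f ≠ 0 from h] using hf))
    have h1 : signComp X Y e = 0 := this he
    have h2 : X e = 0 := he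
    simpa [signComp, h2] using h1
  · rintro ⟨X, hX, rfl⟩
    refine Set.Subset.antisymm (fun e he => ?_) (M.matroid.subset_closure _ (Set.subset_univ _))
    exact (M.mem_closure_matroid_iff _ e).1 he X hX fun a ha => ha

/-- A tope is a maximal covector. -/
def IsTope (M : OrientedMatroid E) (T : E → SignType) : Prop :=
  T ∈ M.covectors ∧ ∀ Y ∈ M.covectors, SignFace T Y → Y = T

/-- An oriented matroid is acyclic if the all-positive sign vector is a covector. -/
def IsAcyclic (M : OrientedMatroid E) : Prop :=
  (fun _ => 1) ∈ M.covectors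

open Classical in
/-- Flip the signs of `X` on `A`. -/
noncomputable def signFlip (A : Set E) (X : E → SignType) : E → SignType :=
  fun e => if e ∈ A then - X e else X e

lemma signFlip_signFlip (A : Set E) (X : E → SignType) : signFlip A (signFlip A X) = X := by
  funext e
  unfold signFlip
  split_ifs <;> simp

/-- The reorientation of `M` on `A`: the signs of all covectors are flipped on `A`. -/
def reorient (M : OrientedMatroid E) (A : Set E) : OrientedMatroid E where
  covectors := {X | signFlip A X ∈ M.covectors}
  zero_mem := by
    have : signFlip A (0 : E → SignType) = 0 := by funext e; simp [signFlip]
    simpa [this] using M.zero_mem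
  neg_mem X hX := by
    have : signFlip A (-X) = - signFlip A X := by funext e; by_cases h : e ∈ A <;> simp [signFlip, h]
    simpa [this] using M.neg_mem _ hX
  comp_mem X hX Y hY := by
    have : signFlip A (signComp X Y) = signComp (signFlip A X) (signFlip A Y) := by
      funext e; by_cases h : e ∈ A <;> by_cases h' : X e = 0 <;> simp [signFlip, signComp, h, h']
    simpa [this] using M.comp_mem _ hX _ hY
  elim X hX Y hY e he := by
    have hsep : ∀ f, SignSep (signFlip A X) (signFlip A Y) f ↔ SignSep X Y f := by
      intro f
      by_cases h : f ∈ A <;> simp [SignSep, signFlip, h, neg_eq_iff_eq_neg]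
    obtain ⟨Z, hZ, hZe, hZf⟩ := M.elim _ hX _ hY e ((hsep e).2 he)
    refine ⟨signFlip A Z, by simpa [signFlip_signFlip] using hZ, by simp [signFlip, hZe], ?_⟩
    intro f hf
    have := hZf f (mt (hsep f).1 hf)
    by_cases h : f ∈ A <;> by_cases h' : X f = 0 <;> simp_all [signFlip, signComp]

/-- The initial oriented matroid `M_ω`, that is the direct sum `⨁ (M | F_i) / F_{i-1}` over the
flag `F_0 ⊂ F_1 ⊂ ⋯` of lower level sets of the weight `ω`. The summand at the level `ω = c` has
the covectors `X` restricted to `{ω = c}`, where `X` is a covector of `M` that vanishes on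
`{ω < c}`; a covector of the direct sum is any concatenation of covectors of the summands.
(A real `c` that is not a value of `ω` imposes no condition.) -/
def initial (M : OrientedMatroid E) (ω : E → ℝ) : OrientedMatroid E where
  covectors := {V | ∀ c : ℝ, ∃ X ∈ M.covectors,
    (∀ e, ω e < c → X e = 0) ∧ ∀ e, ω e = c → V e = X e}
  zero_mem c := ⟨0, M.zero_mem, fun _ _ => rfl, fun _ _ => rfl⟩
  neg_mem V hV c := by
    obtain ⟨X, hX, h1, h2⟩ := hV c
    exact ⟨-X, M.neg_mem X hX, fun e he => by simp [h1 e he], fun e he => by simp [h2 e he]⟩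
  comp_mem V hV W hW c := by
    obtain ⟨X, hX, h1, h2⟩ := hV c
    obtain ⟨Y, hY, h3, h4⟩ := hW c
    exact ⟨signComp X Y, M.comp_mem X hX Y hY, fun e he => by simp [signComp, h1 e he, h3 e he],
      fun e he => by simp [signComp, h2 e he, h4 e he]⟩
  elim V hV W hW e he := by
    classical
    obtain ⟨X, hX, h1, h2⟩ := hV (ω e)
    obtain ⟨Y, hY, h3, h4⟩ := hW (ω e)
    have hsep : ∀ f, ω f = ω e → (SignSep X Y f ↔ SignSep V W f) := fun f hf => by
      simp [SignSep, h2 f hf, h4 f hf]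
    obtain ⟨Z, hZ, hZe, hZf⟩ := M.elim X hX Y hY e ((hsep e rfl).2 he)
    refine ⟨fun f => if ω f = ω e then Z f else signComp V W f, ?_, by simpa using hZe, ?_⟩
    · intro c
      by_cases hc : c = ω e
      · subst hc
        refine ⟨Z, hZ, fun f hf => ?_, fun f hf => by simp [hf]⟩
        rw [hZf f (by simp [SignSep, h1 f hf])]
        simp [signComp, h1 f hf, h3 f hf]
      · obtain ⟨X', hX', h1', h2'⟩ := hV c
        obtain ⟨Y', hY', h3', h4'⟩ := hW c
        refine ⟨signComp X' Y', M.comp_mem X' hX' Y' hY',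
          fun f hf => by simp [signComp, h1' f hf, h3' f hf], fun f hf => ?_⟩
        have : ω f ≠ ω e := by rw [hf]; exact hc
        simp [this, signComp, h2' f hf, h4' f hf]
    · intro f hf
      by_cases h : ω f = ω e
      · simp only [h, if_true]
        rw [hZf f (mt (hsep f h).1 hf)]
        simp [signComp, h2 f h, h4 f h]
      · simp [h]

/-- The bounded complex of the affine oriented matroid `(N, g)`: the covectors `X` with `X g = +`
all of whose nonzero faces `Y` satisfy `Y g = +`. -/
def boundedComplex (N : OrientedMatroid E) (g : E) : Set (E → SignType) :=
  {X | X ∈ N.covectors ∧ X g = 1 ∧ ∀ Y ∈ N.covectors, SignFace Y X → Y = 0 ∨ Y g = 1}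

/-- The bounded topes of `N` with respect to `g`: the maximal elements of the bounded complex. -/
def boundedTopes (N : OrientedMatroid E) (g : E) : Set (E → SignType) :=
  {X | X ∈ N.boundedComplex g ∧ ∀ Y ∈ N.boundedComplex g, SignFace X Y → Y = X}

/-- `N`, on the ground set `E ∪ {g}` with `g = none`, is an extension of `M` by a generic element:
the deletion of `g` from `N` is `M`, the element `g` is neither a loop nor a coloop of `N`, and
`g` is not in the closure of any subset of `E` of rank less than the rank of `M`. -/
structure IsGenericExtension [Finite E] (M : OrientedMatroid E)
    (N : OrientedMatroid (Option E)) : Prop where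
  deletion : M.covectors = (fun X e => X (some e)) '' N.covectors
  not_isLoop : ¬ N.matroid.IsLoop none
  not_isColoop : ¬ N.matroid.IsColoop none
  generic : ∀ A : Set E, M.matroid.eRk A < M.matroid.eRank →
    none ∉ N.matroid.closure (some '' A)

/-- The sign vectors on `E` obtained from the bounded topes of an extension `N` with respect to
`g = none` by deleting `g`. -/
def boundedTopesDelete (N : OrientedMatroid (Option E)) : Set (E → SignType) :=
  (fun X e => X (some e)) '' N.boundedTopes none

end OrientedMatroid

/-- The sphere of weights with coordinate sum zero and Euclidean norm one. -/
def weightSphere (E : Type*) [Fintype E] : Set (E → ℝ) :=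
  {ω | ∑ e, ω e = 0 ∧ ∑ e, ω e ^ 2 = 1}

open Classical in
/-- The weight of a set of elements. -/
noncomputable def setWeight {E : Type*} [Fintype E] (ω : E → ℝ) (B : Set E) : ℝ :=
  ∑ e ∈ B.toFinset, ω e

/-- `B` is a basis of `U` of minimum `ω`-weight, that is a basis of the matroid `U_ω`. -/
def Matroid.IsMinWeightBase {E : Type*} [Fintype E] (U : Matroid E) (ω : E → ℝ) (B : Set E) :
    Prop :=
  U.IsBase B ∧ ∀ C, U.IsBase C → setWeight ω B ≤ setWeight ω C

/-- The Bergman complex of a matroid on the ground set `E`: the weights `ω` on the sphere such that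
`U_ω` has no loops, that is every element lies in some basis of minimum weight. -/
def Matroid.bergman {E : Type*} [Fintype E] (U : Matroid E) : Set (E → ℝ) :=
  {ω | ω ∈ weightSphere E ∧ ∀ e, ∃ B, U.IsMinWeightBase ω B ∧ e ∈ B}

/-- The positive Bergman complex: the weights `ω` on the sphere such that `M_ω` is acyclic. -/
def OrientedMatroid.positiveBergman {E : Type*} [Fintype E] (M : OrientedMatroid E) :
    Set (E → ℝ) :=
  {ω | ω ∈ weightSphere E ∧ (M.initial ω).IsAcyclic}

open Classical in
/-- The Möbius number `μ(U) = μ(0̂, 1̂)` of the lattice of flats of a matroid on a finite set. -/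
noncomputable def Matroid.mobiusNumber {E : Type*} [Fintype E] (U : Matroid E) : ℤ :=
  letI : LocallyFiniteOrder {F : Set E // U.IsFlat F} := Fintype.toLocallyFiniteOrder
  IncidenceAlgebra.mu ℤ (⟨U.closure ∅, U.isFlat_closure ∅⟩ : {F : Set E // U.IsFlat F})
    ⟨U.E, U.ground_isFlat⟩

/-! Write z(X) for the zero set on E of a covector X of N. Everything rests on two facts about the
bounded complex at a generic element g.

Extension (`exists_boundedComplex_extend`): for a bounded covector X and any covector P there is a
bounded X' ≥ X with z(X') = z(X) ∩ z(P). If one step of this failed, two compositions X∘Q and X∘(-Q)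
would both have nonzero faces vanishing at g; eliminating between these faces forces their supports
into z(X), and genericity excludes that. Hence bounded topes are the bounded covectors vanishing
only at loops. Moreover, starting from `exists_mem_boundedComplex`, the flag of sublevel sets of a
Bergman weight lifts, largest proper flat first, to a chain of bounded covectors. Its top member T
is a bounded tope, and the chain shows that T is a covector of M_ω. The other inclusion of the
covering needs no boundedness.

Euler characteristic (`boundedSum_eq`): the signs (-1)^rank z(X) summed over the bounded complex
give minus the sign of the full set {g}ᶜ, as for a contractible complex. Non-coloops are deleted one
at a time, the sum being preserved fibre by fibre, until the complex is a simplex. Applied to the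
contraction by each proper flat F, this says that the bounded covectors with z(X) ⊇ F cancel the
sign of the top flat. Möbius inversion yields the signed count with z(X) the least flat as ±μ. These
covectors are the bounded topes and all carry one sign, so their number is |μ|. -/

/-! ### Faces and compositions of sign vectors -/

/-- The elements other than `g` at which `X` vanishes. -/
def zeroSetOff {α : Type*} (g : α) (X : α → SignType) : Set α := {e | e ≠ g ∧ X e = 0}

lemma SignFace.trans {α : Type*} {X Y Z : α → SignType} (h : SignFace X Y) (h' : SignFace Y Z) :
    SignFace X Z := fun e => by
  rcases h e with h0 | h0
  · exact Or.inl h0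
  · rw [h0]; exact h' e

lemma SignFace.eq_zero {α : Type*} {X Y : α → SignType} (h : SignFace X Y) {e : α}
    (he : Y e = 0) : X e = 0 := by
  rcases h e with h0 | h0
  · exact h0
  · rw [h0, he]

lemma signFace_signComp {α : Type*} (X Y : α → SignType) : SignFace X (signComp X Y) := fun e => by
  by_cases h : X e = 0 <;> simp [signComp, h]

lemma signComp_eq_zero {α : Type*} {X Y : α → SignType} {e : α} :
    signComp X Y e = 0 ↔ X e = 0 ∧ Y e = 0 := by
  by_cases h : X e = 0 <;> simp [signComp, h]

lemma SignType.eq_or_eq_neg {a b : SignType} (ha : a ≠ 0) (hb : b ≠ 0) : a = b ∨ a = -b := by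
  revert a b; decide

/-! ### Bounded covectors at a generic element and their extension -/

namespace OrientedMatroid

variable {α : Type*}

/-- Elimination in which a common face-sign pattern `X` controls the result: two covectors with
opposite signs at `e` whose signs off `e` and off `S` are faces of `X`. -/
lemma exists_elim_face (N : OrientedMatroid α) {X Y Z : α → SignType} {S : Set α}
    (hY : Y ∈ N.covectors) (hZ : Z ∈ N.covectors) {e : α} (hYe : Y e ≠ 0) (hYZ : Y e = - Z e)
    (hYX : ∀ f ∉ S, Y f = 0 ∨ Y f = X f) (hZX : ∀ f ∉ S, Z f = 0 ∨ Z f = X f) :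
    ∃ W ∈ N.covectors, W e = 0 ∧ (∀ f ∉ S, W f = signComp Y Z f) ∧
      ∀ f, Y f = 0 → Z f = 0 → W f = 0 := by
  obtain ⟨W, hW, hWe, hWf⟩ := N.elim Y hY Z hZ e ⟨hYe, hYZ⟩
  refine ⟨W, hW, hWe, fun f hf => hWf f ?_, fun f h1 h2 => ?_⟩
  · rintro ⟨h1, h2⟩
    rcases hYX f hf with h | h
    · exact h1 h
    · rcases hZX f hf with h' | h'
      · rw [h'] at h2; exact h1 (by simpa using h2)
      · rw [h', ← h] at h2
        revert h1 h2
        generalize Y f = a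
        revert a
        decide
  · rw [hWf f (fun h => h.1 h1)]
    simp [signComp, h1, h2]

/-- The element `g` is in general position: it is neither a loop nor a coloop, and it lies in the
closure of a set of other elements only if that set is spanning. -/
structure IsGenericElement (N : OrientedMatroid α) (g : α) : Prop where
  exists_ne_zero : ∃ X ∈ N.covectors, X g ≠ 0
  eq_zero_of_forall_ne : ∀ X ∈ N.covectors, (∀ e, e ≠ g → X e = 0) → X = 0
  transversal : ∀ A : Set α, g ∉ A → (∀ X ∈ N.covectors, (∀ a ∈ A, X a = 0) → X g = 0) →
    N.Transversal A

/-- A nonzero covector that vanishes at a generic element is not minimal on the other elements. -/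
lemma IsGenericElement.exists_zeroSetOff_ssubset {N : OrientedMatroid α} {g : α}
    (hg : N.IsGenericElement g) {Y : α → SignType} (hY : Y ∈ N.covectors) (hY0 : Y ≠ 0)
    (hYg : Y g = 0) : ∃ U ∈ N.covectors, U ≠ 0 ∧ zeroSetOff g Y ⊂ zeroSetOff g U := by
  -- `Y` is nonzero and vanishes on this set, so the set is not spanning; by genericity it does not
  -- span `g`.
  have h1 : ¬ ∀ X ∈ N.covectors, (∀ a ∈ zeroSetOff g Y, X a = 0) → X g = 0 := fun h =>
    hY0 (hg.transversal (zeroSetOff g Y) (fun h => h.1 rfl) h Y hY fun a ha => ha.2)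
  push Not at h1
  obtain ⟨V, hV, hVA, hVg⟩ := h1
  have h2 : ∃ e, e ≠ g ∧ V e ≠ 0 := by
    by_contra! h
    exact hVg (congrFun (hg.eq_zero_of_forall_ne V hV h) g)
  obtain ⟨e, heg, hVe⟩ := h2
  have hYe : Y e ≠ 0 := fun h => hVe (hVA e ⟨heg, h⟩)
  -- Elimination gains the zero `e` and keeps the common zeros; `U g ≠ 0` because `V g ≠ 0` and `Y g
  -- = 0`.
  obtain ⟨U, hU, hUe, hUf⟩ := N.exists_elim hV hY hVe hYe
  refine ⟨U, hU, fun h => ?_, fun f hf => ⟨hf.1, ?_⟩, fun h => hYe (h ⟨heg, hUe⟩).2⟩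
  · exact hVg ((hUf g (Or.inr hYg)).1 (congrFun h g)).1
  · exact (hUf f (Or.inr hf.2)).2 ⟨hVA f hf, hf.2⟩

lemma mem_boundedComplex_of_signFace {N : OrientedMatroid α} {g : α} {X Y : α → SignType}
    (hY : Y ∈ N.boundedComplex g) (hX : X ∈ N.covectors) (hXY : SignFace X Y) (hX0 : X ≠ 0) :
    X ∈ N.boundedComplex g :=
  ⟨hX, (hY.2.2 X hX hXY).resolve_left hX0, fun Z hZ hZX => hY.2.2 Z hZ (hZX.trans hXY)⟩

/-- A covector with `X g = +` that is not bounded has a nonzero face which vanishes at `g`. -/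
lemma exists_face_of_notMem_boundedComplex {N : OrientedMatroid α} {g : α} {X : α → SignType}
    (hX : X ∈ N.covectors) (hXg : X g = 1) (h : X ∉ N.boundedComplex g) :
    ∃ Y ∈ N.covectors, SignFace Y X ∧ Y ≠ 0 ∧ Y g = 0 := by
  have : ∃ Y ∈ N.covectors, SignFace Y X ∧ ¬ (Y = 0 ∨ Y g = 1) := by
    by_contra! hc
    exact h ⟨hX, hXg, hc⟩
  obtain ⟨Y, hY, hYX, h'⟩ := this
  push Not at h'
  refine ⟨Y, hY, hYX, h'.1, (hYX g).resolve_right ?_⟩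
  rw [hXg]
  exact h'.2

/-- Off a generic element `g`, some bounded covector vanishes wherever a given nonzero covector
does. -/
lemma IsGenericElement.exists_mem_boundedComplex [Finite α] {N : OrientedMatroid α} {g : α}
    (hg : N.IsGenericElement g) {P : α → SignType} (hP : P ∈ N.covectors) (hP0 : P ≠ 0) :
    ∃ X ∈ N.boundedComplex g, zeroSetOff g P ⊆ zeroSetOff g X := by
  obtain ⟨Z, hZP, hZ⟩ := (Set.toFinite {Z : Set α | ∃ X ∈ N.covectors, X ≠ 0 ∧
    Z = zeroSetOff g X}).exists_le_maximal ⟨P, hP, hP0, rfl⟩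
  -- A zero set that is maximal off `g` leaves no room for the enlargement that genericity would
  -- give if `Y g = 0`. This covers all nonzero faces of the chosen covector too.
  have key : ∀ Y ∈ N.covectors, Y ≠ 0 → Z ⊆ zeroSetOff g Y → Y g ≠ 0 := by
    intro Y hY hY0 hZY hYg
    obtain ⟨U, hU, hU0, hYU⟩ := hg.exists_zeroSetOff_ssubset hY hY0 hYg
    exact hYU.2 ((hZ.le_of_ge ⟨U, hU, hU0, rfl⟩ (hZY.trans hYU.1)).trans hZY)
  obtain ⟨X, hX, hX0, hZX⟩ := hZ.prop
  have main : ∀ X ∈ N.covectors, Z = zeroSetOff g X → X g = 1 → X ∈ N.boundedComplex g := by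
    intro X hX hZX hXg
    refine ⟨hX, hXg, fun Y hY hYX => ?_⟩
    by_contra! h
    refine key Y hY h.1 (hZX.le.trans fun f hf => ⟨hf.1, ?_⟩) ((hYX g).resolve_right ?_)
    · exact hYX.eq_zero hf.2
    · rw [hXg]; exact h.2
  rcases SignType.eq_or_eq_neg (key X hX hX0 hZX.le) (b := 1) (by decide) with h | h
  · exact ⟨X, main X hX hZX h, hZP.trans hZX.le⟩
  · have hZX' : Z = zeroSetOff g (-X) := by simpa [zeroSetOff] using hZX
    exact ⟨-X, main (-X) (N.neg_mem X hX) hZX' (by simp [h]), hZP.trans hZX'.le⟩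

/-- One step of the extension of bounded covectors. -/
lemma IsGenericElement.exists_boundedComplex_step [Finite α] {N : OrientedMatroid α} {g : α}
    (hg : N.IsGenericElement g) {X P : α → SignType} (hX : X ∈ N.boundedComplex g)
    (hP : P ∈ N.covectors) {e : α} (hXe : X e = 0) (hPe : P e ≠ 0) :
    ∃ X' ∈ N.boundedComplex g, SignFace X X' ∧ (∃ e, X e = 0 ∧ X' e ≠ 0) ∧
      ∀ f, X f = 0 → P f = 0 → X' f = 0 := by
  obtain ⟨Z, hZP, hZ⟩ := (Set.toFinite {Z : Set α | ∃ Q ∈ N.covectors,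
    (∃ e, X e = 0 ∧ Q e ≠ 0) ∧ Z = {f | X f = 0 ∧ Q f = 0}}).exists_le_maximal
    ⟨P, hP, ⟨e, hXe, hPe⟩, rfl⟩
  obtain ⟨Q, hQ, ⟨e, hXe, hQe⟩, rfl⟩ := hZ.prop
  -- A covector vanishing on the common zeros of `X` and `Q` and at one more zero of `X` vanishes
  -- on all zeros of `X`.
  have key : ∀ V ∈ N.covectors, (∀ f, X f = 0 → Q f = 0 → V f = 0) →
      ∀ e', X e' = 0 → Q e' ≠ 0 → V e' = 0 → ∀ f, X f = 0 → V f = 0 := by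
    intro V hV hVQ e' hXe' hQe' hVe' f hXf
    by_contra hVf
    exact hQe' ((hZ.le_of_ge ⟨V, hV, ⟨f, hXf, hVf⟩, rfl⟩
      (fun f hf => ⟨hf.1, hVQ f hf.1 hf.2⟩)) (show e' ∈ {f | X f = 0 ∧ V f = 0} from
        ⟨hXe', hVe'⟩)).2
  have hXg : X g = 1 := hX.2.1
  by_contra! hcon
  -- Used for `R = Q` and `R = -Q`. The unbounded `X ∘ R` has a nonzero face `Y` with `Y g = 0`; if
  -- `Y e = 0`, then `key` would make `Y` a face of `X`, which is bounded.
  have main : ∀ R ∈ N.covectors, (∀ f, R f = 0 ↔ Q f = 0) → ∃ Y ∈ N.covectors, Y g = 0 ∧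
      (∀ f, X f ≠ 0 → Y f = 0 ∨ Y f = X f) ∧ (∀ f, X f = 0 → Y f = 0 ∨ Y f = R f) ∧ Y e ≠ 0 := by
    intro R hR hRQ
    have hc := N.comp_mem X hX.1 R hR
    have hcg : signComp X R g = 1 := by simp [signComp, hXg]
    have hnb : signComp X R ∉ N.boundedComplex g := fun hb => by
      obtain ⟨f, h1, h2, h3⟩ := hcon _ hb (signFace_signComp X R)
        ⟨e, hXe, by simpa [signComp, hXe, hRQ] using hQe⟩
      exact h3 (signComp_eq_zero.2 ⟨h1, (hRQ f).2 ((hZP (show f ∈ {f | X f = 0 ∧ P f = 0} from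
        ⟨h1, h2⟩)).2)⟩)
    obtain ⟨Y, hY, hYX, hY0, hYg⟩ := exists_face_of_notMem_boundedComplex hc hcg hnb
    have h1 : ∀ f, X f ≠ 0 → Y f = 0 ∨ Y f = X f := fun f hf => by
      simpa [signComp, hf] using hYX f
    have h2 : ∀ f, X f = 0 → Y f = 0 ∨ Y f = R f := fun f hf => by
      simpa [signComp, hf] using hYX f
    refine ⟨Y, hY, hYg, h1, h2, fun hYe => ?_⟩
    have h3 := key Y hY (fun f hf hQf => by simpa [(hRQ f).2 hQf] using h2 f hf) e hXe hQe hYe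
    have h4 : SignFace Y X := fun f => by
      by_cases hf : X f = 0
      · exact Or.inl (h3 f hf)
      · exact h1 f hf
    rcases hX.2.2 Y hY h4 with h | h
    · exact hY0 h
    · rw [hYg] at h; exact absurd h (by decide)
  obtain ⟨Y, hY, hYg, hY1, hY2, hYe⟩ := main Q hQ fun _ => Iff.rfl
  obtain ⟨Y', hY', hYg', hY1', hY2', hYe'⟩ := main (-Q) (N.neg_mem Q hQ) fun f => by simp
  have hsep : Y e = - Y' e := by
    rw [(hY2 e hXe).resolve_left hYe, (hY2' e hXe).resolve_left hYe']
    simp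
  -- `W` turns out to be a face of `X` vanishing at `g`, hence zero. Off the zeros of `X`
  -- elimination acts as composition, so `Y` vanishes there and is supported on the zeros of `X`.
  obtain ⟨W, hW, hWe, hW1, hW2⟩ := N.exists_elim_face (S := {f | X f = 0}) hY hY' hYe hsep
    hY1 hY1'
  have hYQ : ∀ f, X f = 0 → Q f = 0 → Y f = 0 := fun f hf hQf => by simpa [hQf] using hY2 f hf
  have hYQ' : ∀ f, X f = 0 → Q f = 0 → Y' f = 0 := fun f hf hQf => by
    simpa [hQf] using hY2' f hf
  have hWX := key W hW (fun f hf hQf => hW2 f (hYQ f hf hQf) (hYQ' f hf hQf)) e hXe hQe hWe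
  have hWface : SignFace W X := fun f => by
    by_cases hf : X f = 0
    · exact Or.inl (hWX f hf)
    · rw [hW1 f hf]
      by_cases h : Y f = 0
      · simpa [signComp, h] using hY1' f hf
      · simpa [signComp, h] using hY1 f hf
  have hWg : W g = 0 := hW2 g hYg hYg'
  have hW0 : W = 0 := (hX.2.2 W hW hWface).resolve_right (by rw [hWg]; decide)
  have hYX : ∀ f, X f ≠ 0 → Y f = 0 := fun f hf => by
    have := hW1 f hf
    rw [hW0] at this
    exact (signComp_eq_zero.1 this.symm).1
  -- The larger zero set given by genericity contains a new zero of `X` outside `Q`, so `key` kills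
  -- `U` on all zeros of `X`; elsewhere off `g` it vanishes with `Y`.
  obtain ⟨U, hU, hU0, hYU⟩ := hg.exists_zeroSetOff_ssubset hY (fun h => hYe (congrFun h e)) hYg
  have hYU' : ∀ f, f ≠ g → Y f = 0 → U f = 0 := fun f hf h => (hYU.1 ⟨hf, h⟩).2
  have hne : ∀ f, X f = 0 → f ≠ g := by
    rintro f hf rfl
    rw [hXg] at hf
    exact absurd hf (by decide)
  obtain ⟨a, haU, haY⟩ := Set.exists_of_ssubset hYU
  have haY' : Y a ≠ 0 := fun h => haY ⟨haU.1, h⟩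
  have haX : X a = 0 := by
    by_contra h
    exact haY' (hYX a h)
  have haQ : Q a ≠ 0 := fun h => haY' (hYQ a haX h)
  have hUX := key U hU (fun f hf hQf => hYU' f (hne f hf) (hYQ f hf hQf)) a haX haQ haU.2
  refine hU0 (hg.eq_zero_of_forall_ne U hU fun f hf => ?_)
  by_cases h : X f = 0
  · exact hUX f h
  · exact hYU' f hf (hYX f h)

/-- A bounded covector extends to a bounded covector with any smaller flat as its zero set. -/
lemma IsGenericElement.exists_boundedComplex_extend [Finite α] {N : OrientedMatroid α} {g : α}
    (hg : N.IsGenericElement g) {X P : α → SignType} (hX : X ∈ N.boundedComplex g)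
    (hP : P ∈ N.covectors) :
    ∃ X' ∈ N.boundedComplex g, SignFace X X' ∧ ∀ f, X' f = 0 ↔ X f = 0 ∧ P f = 0 := by
  obtain ⟨Z, -, hZ⟩ := (Set.toFinite {Z : Set α | ∃ X' ∈ N.boundedComplex g, SignFace X X' ∧
    (∀ f, X f = 0 → P f = 0 → X' f = 0) ∧ Z = {f | X' f = 0}}).exists_le_minimal
    ⟨X, hX, fun _ => Or.inr rfl, fun _ h _ => h, rfl⟩
  obtain ⟨X', hX', hXX', h0, rfl⟩ := hZ.prop
  refine ⟨X', hX', hXX', fun f => ⟨fun hf => ⟨hXX'.eq_zero hf, ?_⟩, fun h => h0 f h.1 h.2⟩⟩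
  by_contra hPf
  obtain ⟨X'', hX'', hf'', ⟨e, he, he'⟩, h0'⟩ := hg.exists_boundedComplex_step hX' hP hf hPf
  exact he' (hZ.le_of_le ⟨X'', hX'', hXX'.trans hf'', fun f h1 h2 => h0' f (h0 f h1 h2) h2, rfl⟩
    (fun f hf => hf''.eq_zero hf) he)

/-- Composition with another covector cannot shrink a minimal zero set, so such a set consists of
loops. -/
lemma exists_forall_eq_zero_of_eq_zero [Finite α] (N : OrientedMatroid α) :
    ∃ P ∈ N.covectors, ∀ e, P e = 0 → ∀ X ∈ N.covectors, X e = 0 := by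
  obtain ⟨Z, -, hZ⟩ := (Set.toFinite {Z : Set α | ∃ X ∈ N.covectors,
    Z = {f | X f = 0}}).exists_le_minimal ⟨0, N.zero_mem, rfl⟩
  obtain ⟨P, hP, rfl⟩ := hZ.prop
  refine ⟨P, hP, fun e he X hX => ?_⟩
  exact (signComp_eq_zero.1 (hZ.le_of_le ⟨_, N.comp_mem P hP X hX, rfl⟩
    (fun f hf => (signComp_eq_zero.1 hf).1) he)).2

/-- The bounded topes with respect to a generic element are the bounded covectors that vanish at
loops only. -/
lemma IsGenericElement.mem_boundedTopes_iff [Finite α] {N : OrientedMatroid α} {g : α}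
    (hg : N.IsGenericElement g) {X : α → SignType} :
    X ∈ N.boundedTopes g ↔ X ∈ N.boundedComplex g ∧
      ∀ e, X e = 0 → ∀ Y ∈ N.covectors, Y e = 0 := by
  constructor
  · rintro ⟨hX, hmax⟩
    refine ⟨hX, fun e he => ?_⟩
    obtain ⟨P, hP, hPe⟩ := N.exists_forall_eq_zero_of_eq_zero
    obtain ⟨X', hX', hXX', h0⟩ := hg.exists_boundedComplex_extend hX hP
    rw [← hmax X' hX' hXX'] at he
    exact hPe e ((h0 e).1 he).2
  · rintro ⟨hX, h0⟩
    refine ⟨hX, fun Y hY hXY => funext fun e => ?_⟩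
    rcases hXY e with h | h
    · rw [h, h0 e h Y hY.1]
    · exact h.symm

end OrientedMatroid

/-! ### Deletion, contraction and the fibres of deletion -/

namespace OrientedMatroid

variable {α : Type*}

/-- The deletion of `e`, on the same ground set: `e` becomes a loop. -/
def delete [DecidableEq α] (N : OrientedMatroid α) (e : α) : OrientedMatroid α where
  covectors := (fun X => Function.update X e 0) '' N.covectors
  zero_mem := ⟨0, N.zero_mem, by simp⟩
  neg_mem := by
    rintro _ ⟨X, hX, rfl⟩
    refine ⟨-X, N.neg_mem X hX, funext fun f => ?_⟩
    by_cases h : f = e <;> simp [h]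
  comp_mem := by
    rintro _ ⟨X, hX, rfl⟩ _ ⟨Y, hY, rfl⟩
    refine ⟨signComp X Y, N.comp_mem X hX Y hY, funext fun f => ?_⟩
    by_cases h : f = e <;> simp [signComp, h]
  elim := by
    rintro _ ⟨X, hX, rfl⟩ _ ⟨Y, hY, rfl⟩ f hf
    have hfe : f ≠ e := by
      rintro rfl
      exact hf.1 (by simp)
    have hsep : ∀ f, f ≠ e → (SignSep (Function.update X e 0) (Function.update Y e 0) f ↔
        SignSep X Y f) := fun f hf => by simp [SignSep, hf]
    obtain ⟨Z, hZ, hZf, hZ'⟩ := N.elim X hX Y hY f ((hsep f hfe).1 hf)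
    refine ⟨_, ⟨Z, hZ, rfl⟩, by simp [Function.update_apply, hZf], fun f' hf' => ?_⟩
    by_cases h : f' = e
    · simp [h, signComp]
    · simp [h, hZ' f' (mt (hsep f' h).2 hf'), signComp]

/-- The contraction of `F`, on the same ground set: the elements of `F` become loops. -/
def contract (N : OrientedMatroid α) (F : Set α) : OrientedMatroid α where
  covectors := {X ∈ N.covectors | ∀ e ∈ F, X e = 0}
  zero_mem := ⟨N.zero_mem, fun _ _ => rfl⟩
  neg_mem X hX := ⟨N.neg_mem X hX.1, fun e he => by simp [hX.2 e he]⟩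
  comp_mem X hX Y hY := ⟨N.comp_mem X hX.1 Y hY.1, fun e he =>
    signComp_eq_zero.2 ⟨hX.2 e he, hY.2 e he⟩⟩
  elim X hX Y hY e he := by
    obtain ⟨Z, hZ, hZe, hZf⟩ := N.elim X hX.1 Y hY.1 e he
    refine ⟨Z, ⟨hZ, fun f hf => ?_⟩, hZe, hZf⟩
    rw [hZf f fun h => h.1 (hX.2 f hf)]
    exact signComp_eq_zero.2 ⟨hX.2 f hf, hY.2 f hf⟩

/-- `ε` behaves like `(-1) ^ r(A)` for the rank function `r` of `N`. -/
structure IsRankSign (N : OrientedMatroid α) (ε : Set α → ℤ) : Prop where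
  insert_eq : ∀ A e, (∀ X ∈ N.covectors, (∀ a ∈ A, X a = 0) → X e = 0) → ε (insert e A) = ε A
  insert_eq_neg : ∀ A, ∀ X ∈ N.covectors, (∀ a ∈ A, X a = 0) → ∀ e, X e ≠ 0 →
    ε (insert e A) = - ε A

/-- The rank of `A` in the contraction differs from that of `A ∪ F` by a constant, and `IsRankSign`
does not normalise the global sign. -/
lemma IsRankSign.contract {N : OrientedMatroid α} {ε : Set α → ℤ} (hε : N.IsRankSign ε)
    (F : Set α) : (N.contract F).IsRankSign fun A => ε (A ∪ F) where
  insert_eq A e h := by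
    rw [Set.insert_union]
    exact hε.insert_eq _ e fun X hX h0 =>
      h X ⟨hX, fun a ha => h0 a (Or.inr ha)⟩ fun a ha => h0 a (Or.inl ha)
  insert_eq_neg A X hX h0 e he := by
    rw [Set.insert_union]
    refine hε.insert_eq_neg _ X hX.1 ?_ e he
    rintro a (ha | ha)
    · exact h0 a ha
    · exact hX.2 a ha

lemma IsRankSign.delete [DecidableEq α] {N : OrientedMatroid α} {ε : Set α → ℤ}
    (hε : N.IsRankSign ε) (e : α) : (N.delete e).IsRankSign fun A => ε (A \ {e}) where
  insert_eq A f h := by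
    by_cases hf : f = e
    · simp [hf]
    · rw [Set.insert_sdiff_of_notMem _ (by simpa using hf)]
      refine hε.insert_eq _ f fun X hX h0 => ?_
      have := h _ ⟨X, hX, rfl⟩ fun a ha => by
        by_cases hae : a = e
        · simp [hae]
        · simpa [hae] using h0 a ⟨ha, hae⟩
      simpa [hf] using this
  insert_eq_neg := by
    rintro A _ ⟨X, hX, rfl⟩ h0 f hf
    have hfe : f ≠ e := by
      rintro rfl
      simp at hf
    rw [Set.insert_sdiff_of_notMem _ (by simpa using hfe)]
    refine hε.insert_eq_neg _ X hX (fun a ha => ?_) f (by simpa [hfe] using hf)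
    have hae : a ≠ e := ha.2
    simpa [hae] using h0 a ha.1

/-- The covector `P` witnesses that `F` is not spanning, which keeps `g` from becoming a loop. -/
lemma IsGenericElement.contract {N : OrientedMatroid α} {g : α} (hg : N.IsGenericElement g)
    {F : Set α} (hgF : g ∉ F) {P : α → SignType} (hP : P ∈ N.covectors) (hP0 : P ≠ 0)
    (hPF : ∀ e ∈ F, P e = 0) : (N.contract F).IsGenericElement g where
  exists_ne_zero := by
    by_contra! h
    exact hP0 (hg.transversal F hgF (fun X hX hXF => h X ⟨hX, hXF⟩) P hP hPF)
  eq_zero_of_forall_ne X hX := hg.eq_zero_of_forall_ne X hX.1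
  transversal A hgA h X hX hXA := by
    refine hg.transversal (A ∪ F) (by simp [hgA, hgF]) (fun Y hY hYA => ?_) X hX.1 ?_
    · exact h Y ⟨hY, fun e he => hYA e (Or.inr he)⟩ fun a ha => hYA a (Or.inl ha)
    · rintro a (ha | ha)
      · exact hXA a ha
      · exact hX.2 a ha

/-- The hypothesis `he` says that `e` is not a coloop once `g` is removed; it keeps `g` from
becoming a coloop. -/
lemma IsGenericElement.delete [DecidableEq α] {N : OrientedMatroid α} {g e : α}
    (hg : N.IsGenericElement g) (heg : e ≠ g)
    (he : ∀ X ∈ N.covectors, (∀ f, f ≠ e → f ≠ g → X f = 0) → X = 0) :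
    (N.delete e).IsGenericElement g where
  exists_ne_zero := by
    obtain ⟨X, hX, hXg⟩ := hg.exists_ne_zero
    exact ⟨_, ⟨X, hX, rfl⟩, by simpa [heg.symm] using hXg⟩
  eq_zero_of_forall_ne := by
    rintro _ ⟨X, hX, rfl⟩ h
    rw [he X hX fun f hfe hfg => by simpa [hfe] using h f hfg]
    simp
  transversal := by
    rintro A hgA h _ ⟨X, hX, rfl⟩ hXA
    have h1 : ∀ X : α → SignType, (∀ a ∈ A \ {e}, X a = 0) →
        ∀ a ∈ A, Function.update X e 0 a = 0 := fun X h0 a ha => by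
      by_cases hae : a = e
      · simp [hae]
      · simpa [hae] using h0 a ⟨ha, hae⟩
    rw [hg.transversal (A \ {e}) (fun h => hgA h.1) (fun Y hY hYA => ?_) X hX fun a ha => ?_]
    · simp
    · simpa [heg.symm] using h _ ⟨Y, hY, rfl⟩ (h1 Y hYA)
    · have hae : a ≠ e := ha.2
      simpa [hae] using hXA a ha.1

lemma mem_boundedComplex_contract {N : OrientedMatroid α} {g : α} {F : Set α}
    {X : α → SignType} : X ∈ (N.contract F).boundedComplex g ↔
      X ∈ N.boundedComplex g ∧ ∀ e ∈ F, X e = 0 := by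
  constructor
  · rintro ⟨hX, hXg, h⟩
    exact ⟨⟨hX.1, hXg, fun Y hY hYX => h Y ⟨hY, fun e he => hYX.eq_zero (hX.2 e he)⟩ hYX⟩, hX.2⟩
  · rintro ⟨⟨hX, hXg, h⟩, hXF⟩
    exact ⟨⟨hX, hXF⟩, hXg, fun Y hY => h Y hY.1⟩

section Fiber

variable [DecidableEq α] {N : OrientedMatroid α} {g e : α} {Y : α → SignType}

lemma update_mem_of_zero_mem {s : SignType} (h0 : Function.update Y e 0 ∈ N.covectors)
    {V : α → SignType} (hV : V ∈ N.covectors) (hVY : ∀ f, f ≠ e → V f = 0 ∨ V f = Y f)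
    (hVe : V e = s) : Function.update Y e s ∈ N.covectors := by
  convert N.comp_mem _ h0 V hV using 1
  funext f
  by_cases hf : f = e
  · subst hf; simp [signComp, hVe]
  · rcases hVY f hf with h | h <;> simp +contextual [signComp, hf, h]

/-- Elimination at `e` leaves the other signs of `Y` intact, because `V` is a face of `Y` there. -/
lemma update_zero_mem {s : SignType} (hs : s ≠ 0) (h : Function.update Y e s ∈ N.covectors)
    {V : α → SignType} (hV : V ∈ N.covectors) (hVY : ∀ f, f ≠ e → V f = 0 ∨ V f = Y f)
    (hVe : V e = -s) : Function.update Y e 0 ∈ N.covectors := by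
  obtain ⟨W, hW, hWe, hW1, -⟩ := N.exists_elim_face (S := {e}) (X := Y) h hV (e := e)
    (by simpa using hs) (by simp [hVe]) (fun f hf => Or.inr (by simp [show f ≠ e from hf]))
    (fun f hf => hVY f hf)
  convert hW using 1
  funext f
  by_cases hf : f = e
  · subst hf; simp [hWe]
  · rw [hW1 f hf]
    rcases hVY f hf with h | h <;> simp +contextual [signComp, hf, h]

/-- The values at `e` of the covectors which agree with `Y` elsewhere form one of five sets. -/
lemma update_mem_cases (N : OrientedMatroid α) (e : α) (Y : α → SignType) :
    (∀ s, Function.update Y e s ∉ N.covectors) ∨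
    (∃ s, Function.update Y e s ∈ N.covectors ∧
      ∀ t, Function.update Y e t ∈ N.covectors → t = s) ∨
    ∀ s, Function.update Y e s ∈ N.covectors := by
  have h1 : ∀ s t : SignType, s ≠ t → Function.update Y e s ∈ N.covectors →
      Function.update Y e t ∈ N.covectors → Function.update Y e 0 ∈ N.covectors := by
    intro s t hst hs ht
    by_cases hs0 : s = 0
    · rwa [hs0] at hs
    by_cases ht0 : t = 0
    · rwa [ht0] at ht
    refine update_zero_mem hs0 hs ht (fun f hf => Or.inr (by simp [hf])) ?_
    rcases SignType.eq_or_eq_neg ht0 hs0 with h | h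
    · exact absurd h.symm hst
    · simpa using h
  have h2 : ∀ s : SignType, s ≠ 0 → Function.update Y e s ∈ N.covectors →
      Function.update Y e 0 ∈ N.covectors → ∀ t, Function.update Y e t ∈ N.covectors := by
    intro s hs0 hs h0 t
    by_cases ht0 : t = 0
    · rwa [ht0]
    rcases SignType.eq_or_eq_neg ht0 hs0 with rfl | rfl
    · exact hs
    convert N.comp_mem _ h0 _ (N.neg_mem _ hs) using 1
    funext f
    by_cases hf : f = e
    · subst hf; simp [signComp]
    · by_cases h : Y f = 0 <;> simp [signComp, hf, h]
  by_cases hex : ∃ s, Function.update Y e s ∈ N.covectors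
  · obtain ⟨s, hs⟩ := hex
    by_cases hu : ∀ t, Function.update Y e t ∈ N.covectors → t = s
    · exact Or.inr (Or.inl ⟨s, hs, hu⟩)
    · push Not at hu
      obtain ⟨t, ht, hts⟩ := hu
      have h0 := h1 s t hts.symm hs ht
      by_cases hs0 : s = 0
      · exact Or.inr (Or.inr (h2 t (hs0 ▸ hts) ht h0))
      · exact Or.inr (Or.inr (h2 s hs0 hs h0))
  · exact Or.inl (not_exists.1 hex)

lemma signFace_update {V : α → SignType} {s : SignType} (hVe : V e = 0 ∨ V e = s)
    (hV : ∀ f, f ≠ e → V f = 0 ∨ V f = Y f) : SignFace V (Function.update Y e s) := fun f => by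
  by_cases hf : f = e
  · subst hf; simpa using hVe
  · simpa [hf] using hV f hf

lemma eq_zero_or_eq_of_signFace_update {V : α → SignType} {s : SignType}
    (h : SignFace V (Function.update Y e s)) {f : α} (hf : f ≠ e) : V f = 0 ∨ V f = Y f := by
  simpa [hf] using h f

/-- Erasing `e` turns a face of the lift into a face of `Y`. If nothing remains, the face was
supported at `e`, which `he` excludes. -/
lemma update_mem_boundedComplex_of_delete (heg : e ≠ g)
    (he : ∀ X ∈ N.covectors, (∀ f, f ≠ e → X f = 0) → X = 0)
    (hY : Y ∈ (N.delete e).boundedComplex g) {s : SignType}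
    (hs : Function.update Y e s ∈ N.covectors) :
    Function.update Y e s ∈ N.boundedComplex g := by
  refine ⟨hs, by simpa [heg.symm] using hY.2.1, fun Z hZ hZY => ?_⟩
  have hface : SignFace (Function.update Z e 0) Y := fun f => by
    by_cases hf : f = e
    · simp [hf]
    · simpa [hf] using eq_zero_or_eq_of_signFace_update hZY hf
  rcases hY.2.2 _ ⟨Z, hZ, rfl⟩ hface with h | h
  · refine Or.inl (he Z hZ fun f hf => ?_)
    simpa [hf] using congrFun h f
  · exact Or.inr (by simpa [heg.symm] using h)

/-- A face of `Y` in the deletion comes from a covector `Z` of `N`. The hypothesis `h` makes `Z` a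
face of a bounded lift: the one with value `Z e`, or else the one with value `s`. -/
lemma mem_boundedComplex_delete (heg : e ≠ g) (hYe : Y e = 0) {s : SignType}
    (hs : Function.update Y e s ∈ N.boundedComplex g)
    (h : ∀ Z ∈ N.covectors, (∀ f, f ≠ e → Z f = 0 ∨ Z f = Y f) →
      Function.update Y e (Z e) ∉ N.boundedComplex g → Z e = 0) :
    Y ∈ (N.delete e).boundedComplex g := by
  refine ⟨⟨_, hs.1, by simp [← hYe]⟩, by simpa [heg.symm] using hs.2.1, ?_⟩
  rintro _ ⟨Z, hZ, rfl⟩ hZY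
  have hZY' : ∀ f, f ≠ e → Z f = 0 ∨ Z f = Y f := fun f hf => by simpa [hf] using hZY f
  have : ∃ t, Function.update Y e t ∈ N.boundedComplex g ∧ (Z e = 0 ∨ Z e = t) := by
    by_cases hb : Function.update Y e (Z e) ∈ N.boundedComplex g
    · exact ⟨_, hb, Or.inr rfl⟩
    · exact ⟨s, hs, Or.inl (h Z hZ hZY' hb)⟩
  obtain ⟨t, ht, hte⟩ := this
  rcases ht.2.2 Z hZ (signFace_update hte hZY') with h0 | h1
  · exact Or.inl (by simp [h0])
  · exact Or.inr (by simpa [heg.symm] using h1)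

/-- If both sides were unbounded, each would have a face vanishing at `g` and nonzero at `e`.
Eliminating `e` gives a face of the middle lift vanishing at `g`, hence zero; so the first face is
supported at `e` alone, against `he`. -/
lemma update_mem_boundedComplex_of_zero (heg : e ≠ g)
    (he : ∀ X ∈ N.covectors, (∀ f, f ≠ e → X f = 0) → X = 0)
    (hall : ∀ s, Function.update Y e s ∈ N.covectors)
    (h0 : Function.update Y e 0 ∈ N.boundedComplex g) :
    Function.update Y e 1 ∈ N.boundedComplex g ∨
      Function.update Y e (-1) ∈ N.boundedComplex g := by
  have hYg : Y g = 1 := by simpa [heg.symm] using h0.2.1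
  have main : ∀ s, Function.update Y e s ∉ N.boundedComplex g → ∃ Z ∈ N.covectors,
      (∀ f, f ≠ e → Z f = 0 ∨ Z f = Y f) ∧ Z e ≠ 0 ∧ Z e = s ∧ Z g = 0 := by
    intro s hs
    obtain ⟨Z, hZ, hZY, hZ0, hZg⟩ := exists_face_of_notMem_boundedComplex (hall s)
      (by simpa [heg.symm] using hYg) hs
    have hZe : Z e ≠ 0 := fun hZe => by
      rcases h0.2.2 Z hZ (signFace_update (Or.inl hZe) fun f => eq_zero_or_eq_of_signFace_update hZY) with h | h
      · exact hZ0 h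
      · rw [hZg] at h; exact absurd h (by decide)
    refine ⟨Z, hZ, fun f => eq_zero_or_eq_of_signFace_update hZY, hZe, ?_, hZg⟩
    simpa [hZe] using hZY e
  by_contra! h
  obtain ⟨Z, hZ, hZY, hZe, hZs, hZg⟩ := main 1 h.1
  obtain ⟨Z', hZ', hZY', hZe', hZs', hZg'⟩ := main (-1) h.2
  obtain ⟨W, hW, hWe, hW1, hW2⟩ := N.exists_elim_face (S := {e}) (X := Y) hZ hZ' hZe
    (by simp [hZs, hZs']) hZY hZY'
  have hWf : SignFace W (Function.update Y e 0) := signFace_update (Or.inl hWe) fun f hf => by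
    rw [hW1 f hf]
    rcases hZY f hf with h | h
    · simpa [signComp, h] using hZY' f hf
    · by_cases hY : Y f = 0
      · simpa [signComp, h, hY] using hZY' f hf
      · simp [signComp, h, hY]
  have hW0 : W = 0 := (h0.2.2 W hW hWf).resolve_right (by rw [hW2 g hZg hZg']; decide)
  refine hZe (congrFun (he Z hZ fun f hf => ?_) e)
  have := hW1 f hf
  rw [hW0] at this
  exact (signComp_eq_zero.1 this.symm).1

end Fiber

end OrientedMatroid

/-! ### The Euler characteristic of the bounded complex -/

namespace OrientedMatroid

variable {α : Type*}

/-- The sum of `ε` over the zero sets of the bounded covectors. -/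
noncomputable def boundedSum [Finite α] (N : OrientedMatroid α) (g : α) (ε : Set α → ℤ) : ℤ :=
  ∑ X ∈ (Set.toFinite (N.boundedComplex g)).toFinset, ε {e | X e = 0}

open Classical in
-- A unique lift contributes the sign of `Y` itself. If all three values occur, the middle lift has
-- the sign opposite to the sides: the total is 1 + 1 - 1 if both sides are bounded, which is when
-- `Y` is; it is 1 - 1 if one side is, and the middle lift is never bounded alone.
lemma sum_fiber_boundedComplex {N : OrientedMatroid α} {g e : α} (heg : e ≠ g)
    (he : ∀ X ∈ N.covectors, (∀ f, f ≠ e → X f = 0) → X = 0) {ε : Set α → ℤ}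
    (hε : N.IsRankSign ε) {Y : α → SignType} (hYe : Y e = 0) :
    (∑ s : SignType, if Function.update Y e s ∈ N.boundedComplex g then
      ε {f | Function.update Y e s f = 0} else 0) =
      if Y ∈ (N.delete e).boundedComplex g then ε ({f | Y f = 0} \ {e}) else 0 := by
  have hset : ∀ s : SignType, s ≠ 0 →
      {f | Function.update Y e s f = 0} = {f | Y f = 0} \ {e} := by
    intro s hs
    ext f
    by_cases hf : f = e
    · subst hf; simp [hs]
    · simp [hf]
  have hset0 : {f | Function.update Y e 0 f = 0} = insert e ({f | Y f = 0} \ {e}) := by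
    ext f
    by_cases hf : f = e
    · subst hf; simp
    · simp [hf]
  have huniv : ∀ w : SignType → ℤ, ∑ s, w s = w 0 + w 1 + w (-1) := by
    intro w
    rw [show (Finset.univ : Finset SignType) = {0, 1, -1} from by decide]
    simp [add_assoc]
  rcases N.update_mem_cases e Y with h | ⟨s, hs, hu⟩ | hall
  · rw [if_neg fun hY => ?_]
    · exact Finset.sum_eq_zero fun s _ => if_neg fun hb => h s hb.1
    · obtain ⟨X, hX, hXY⟩ := hY.1
      refine h (X e) ?_
      rw [← hXY]
      simpa using hX
  · have hiff : Function.update Y e s ∈ N.boundedComplex g ↔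
        Y ∈ (N.delete e).boundedComplex g := by
      refine ⟨fun hb => mem_boundedComplex_delete heg hYe hb fun Z hZ hZY hnb => ?_,
        fun hb => update_mem_boundedComplex_of_delete heg he hb hs⟩
      by_contra hZe
      by_cases hs0 : s = 0
      · subst hs0
        exact hZe (hu _ (update_mem_of_zero_mem hs hZ hZY rfl))
      · rcases SignType.eq_or_eq_neg hZe hs0 with h | h
        · rw [h] at hnb; exact hnb hb
        · exact hs0 (hu _ (update_zero_mem hs0 hs hZ hZY h)).symm
    have hval : ε {f | Function.update Y e s f = 0} = ε ({f | Y f = 0} \ {e}) := by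
      by_cases hs0 : s = 0
      · subst hs0
        rw [hset0]
        -- A covector nonzero at `e` and zero on the other zeros of `Y` would, by composition, give
        -- a second lift; so `e` adds no rank.
        refine hε.insert_eq _ _ fun V hV hV0 => ?_
        have hV' := N.comp_mem _ hs V hV
        rw [← hu (V e)]
        convert hV' using 1
        funext f
        by_cases hf : f = e
        · subst hf; simp [signComp]
        · by_cases hYf : Y f = 0
          · simp [signComp, hf, hYf, hV0 f ⟨hYf, hf⟩]
          · simp [signComp, hf, hYf]
      · rw [hset s hs0]
    rw [Finset.sum_eq_single s (fun t _ hts => if_neg fun hb => hts (hu t hb.1)) (by simp), hval]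
    simp only [hiff]
  · have h01 : ∀ s, Function.update Y e s ∈ N.boundedComplex g →
        Function.update Y e 0 ∈ N.boundedComplex g := fun s hb =>
      mem_boundedComplex_of_signFace hb (hall 0)
        (signFace_update (by simp) fun f hf => by simp [hf]) fun h => by
          have := hb.2.1
          rw [Function.update_of_ne heg.symm] at this
          have h' := congrFun h g
          rw [Function.update_of_ne heg.symm, this] at h'
          exact one_ne_zero h'
    have hneg : ε {f | Function.update Y e 0 f = 0} = - ε ({f | Y f = 0} \ {e}) := by
      rw [hset0]
      refine hε.insert_eq_neg _ _ (hall 1) (fun f hf => ?_) e (by simp)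
      simpa [show f ≠ e from hf.2] using hf.1
    have hY : Y ∈ (N.delete e).boundedComplex g ↔ Function.update Y e 1 ∈ N.boundedComplex g ∧
        Function.update Y e (-1) ∈ N.boundedComplex g := by
      refine ⟨fun hb => ⟨update_mem_boundedComplex_of_delete heg he hb (hall _),
        update_mem_boundedComplex_of_delete heg he hb (hall _)⟩, fun ⟨h1, h2⟩ =>
        mem_boundedComplex_delete heg hYe h1 fun Z _ _ hnb => ?_⟩
      by_contra hZe
      rcases SignType.eq_or_eq_neg hZe (b := 1) (by decide) with h | h <;> rw [h] at hnb
      · exact hnb h1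
      · exact hnb h2
    rw [huniv]
    simp only [hneg, hset 1 (by decide), hset (-1) (by decide), hY]
    have hor := update_mem_boundedComplex_of_zero heg he hall
    have h1 := h01 1
    have h2 := h01 (-1)
    by_cases b0 : Function.update Y e 0 ∈ N.boundedComplex g
    · by_cases b1 : Function.update Y e 1 ∈ N.boundedComplex g <;>
        by_cases b2 : Function.update Y e (-1) ∈ N.boundedComplex g
      · simp [b0, b1, b2]
      · simp [b0, b1, b2]
      · simp [b0, b1, b2]
      · exact absurd (hor b0) (by simp [b1, b2])
    · simp [b0, mt h1 b0, mt h2 b0]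

open Classical in
lemma boundedSum_delete [Finite α] {N : OrientedMatroid α} {g e : α} (heg : e ≠ g)
    (he : ∀ X ∈ N.covectors, (∀ f, f ≠ e → X f = 0) → X = 0) {ε : Set α → ℤ}
    (hε : N.IsRankSign ε) :
    (N.delete e).boundedSum g (fun A => ε (A \ {e})) = N.boundedSum g ε := by
  have := Fintype.ofFinite α
  have hL : (N.delete e).boundedSum g (fun A => ε (A \ {e})) = ∑ Y : α → SignType,
      if Y ∈ (N.delete e).boundedComplex g then ε ({f | Y f = 0} \ {e}) else 0 := by
    rw [boundedSum, ← Finset.sum_filter]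
    exact Finset.sum_congr (by ext; simp) fun _ _ => rfl
  rw [hL, boundedSum, ← Finset.sum_fiberwise (Set.toFinite (N.boundedComplex g)).toFinset
    (fun X => Function.update X e 0)]
  refine Finset.sum_congr rfl fun Y _ => ?_
  by_cases hYe : Y e = 0
  · rw [← sum_fiber_boundedComplex heg he hε hYe, ← Finset.sum_filter]
    refine Finset.sum_bij (fun s _ => Function.update Y e s) (fun s hs => ?_)
      (fun s _ t _ h => by simpa using congrFun h e) (fun X hX => ?_) fun _ _ => rfl
    · simp only [Finset.mem_filter, Finset.mem_univ, true_and] at hs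
      simp [hs, ← hYe]
    · simp only [Finset.mem_filter, Set.Finite.mem_toFinset] at hX
      have hXY : Function.update Y e (X e) = X := by simp [← hX.2]
      exact ⟨X e, by simpa [hXY] using hX.1, hXY⟩
  · rw [if_neg, Finset.sum_eq_zero]
    · intro X hX
      rw [Finset.mem_filter] at hX
      exact absurd (by simp [← hX.2]) hYe
    · rintro ⟨⟨X, -, rfl⟩, -⟩
      simp at hYe

/-- If `X g = 0`, genericity would give a nonzero covector with a larger zero set off `g`; the only
possible new zero is `e`, which leaves a covector supported at `g` alone. -/
lemma IsGenericElement.exists_covector_of_coloop {N : OrientedMatroid α} {g e : α}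
    (hg : N.IsGenericElement g) {X : α → SignType} (hX : X ∈ N.covectors)
    (hX0 : X ≠ 0) (h : ∀ f, f ≠ e → f ≠ g → X f = 0) :
    ∃ Y ∈ N.covectors, Y g = 1 ∧ Y e ≠ 0 ∧ ∀ f, f ≠ e → f ≠ g → Y f = 0 := by
  have hXe : X e ≠ 0 := fun hXe => hX0 (hg.eq_zero_of_forall_ne X hX fun f hf => by
    by_cases hfe : f = e
    · rw [hfe, hXe]
    · exact h f hfe hf)
  have hXg : X g ≠ 0 := fun hXg => by
    obtain ⟨U, hU, hU0, hXU⟩ := hg.exists_zeroSetOff_ssubset hX hX0 hXg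
    obtain ⟨a, ha, haX⟩ := Set.exists_of_ssubset hXU
    have hae : a = e := by
      by_contra hae
      exact haX ⟨ha.1, h a hae ha.1⟩
    refine hU0 (hg.eq_zero_of_forall_ne U hU fun f hf => ?_)
    by_cases hfe : f = e
    · rw [hfe, ← hae]; exact ha.2
    · exact (hXU.1 ⟨hf, h f hfe hf⟩).2
  rcases SignType.eq_or_eq_neg hXg (b := 1) (by decide) with h1 | h1
  · exact ⟨X, hX, h1, hXe, h⟩
  · exact ⟨-X, N.neg_mem X hX, by simp [h1], by simpa using hXe,
      fun f hfe hfg => by simp [h f hfe hfg]⟩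

open Classical in
/-- If every element other than the generic element `g` is a loop or a coloop of the deletion of
`g`, then the bounded complex is the face poset of a simplex. -/
lemma IsGenericElement.boundedSum_simplex [Finite α] {N : OrientedMatroid α} {g : α}
    (hg : N.IsGenericElement g) {ε : Set α → ℤ} (hε : N.IsRankSign ε)
    (hcol : ∀ e, e ≠ g → (∃ X ∈ N.covectors, X e ≠ 0) → ∃ X ∈ N.covectors, X ≠ 0 ∧
      ∀ f, f ≠ e → f ≠ g → X f = 0) :
    N.boundedSum g ε = - ε {g}ᶜ := by
  have := Fintype.ofFinite α
  let B : Finset α := Finset.univ.filter fun e => e ≠ g ∧ ∃ X ∈ N.covectors, X e ≠ 0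
  have hB : ∀ {e}, e ∈ B ↔ e ≠ g ∧ ∃ X ∈ N.covectors, X e ≠ 0 := fun {e} => by simp [B]
  have hC : ∀ e, ∃ Y : α → SignType, e ∈ B → Y ∈ N.covectors ∧ Y g = 1 ∧ Y e ≠ 0 ∧
      ∀ f, f ≠ e → f ≠ g → Y f = 0 := by
    intro e
    by_cases he : e ∈ B
    · obtain ⟨X, hX, hX0, h⟩ := hcol e (hB.1 he).1 (hB.1 he).2
      obtain ⟨Y, hY⟩ := hg.exists_covector_of_coloop hX hX0 h
      exact ⟨Y, fun _ => hY⟩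
    · exact ⟨0, fun h => absurd h he⟩
  choose C hC using hC
  -- `C e` is the vertex of the simplex labelled `e`, and `V S` is the face spanned by the vertices
  -- in `S`.
  let V : Finset α → α → SignType := fun S f => if f = g then 1 else if f ∈ S then C f f else 0
  have hVg : ∀ S, V S g = 1 := fun S => by simp [V]
  have hVf : ∀ S f, f ≠ g → V S f = if f ∈ S then C f f else 0 := fun S f hf => by simp [V, hf]
  have hVmem : ∀ S : Finset α, S ⊆ B → S.Nonempty → V S ∈ N.covectors := by
    intro S
    induction S using Finset.induction_on with
    | empty => simp
    | insert e S heS ih =>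
      intro hSB _
      obtain ⟨hCe, hCg, hCne, hC0⟩ := hC e (hSB (Finset.mem_insert_self e S))
      have heg := (hB.1 (hSB (Finset.mem_insert_self e S))).1
      rcases S.eq_empty_or_nonempty with rfl | hS
      · convert hCe using 1
        funext f
        by_cases hf : f = g
        · simp [hf, hVg, hCg]
        · rw [hVf _ f hf]
          by_cases hfe : f = e
          · simp [hfe]
          · simp [hfe, hC0 f hfe hf]
      · convert N.comp_mem _ (ih ((Finset.subset_insert e S).trans hSB) hS) _ hCe using 1
        funext f
        by_cases hf : f = g
        · simp [signComp, hf, hVg]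
        · simp only [signComp, hVf _ f hf]
          by_cases hfe : f = e
          · simp [hfe, heS]
          · by_cases hfS : f ∈ S <;> simp +contextual [hfe, hfS, hC0 f hfe hf]
  -- No nonzero covector is nonpositive at `g` and agrees elsewhere with the apex vectors.
  have hno : ∀ S : Finset α, ∀ Y ∈ N.covectors, (∀ f, f ≠ g → f ∉ S → Y f = 0) →
      (∀ f, f ≠ g → Y f = 0 ∨ Y f = C f f) → (Y g = 0 ∨ Y g = -1) → Y = 0 := by
    intro S
    induction S using Finset.induction_on with
    | empty => exact fun Y hY h0 _ _ => hg.eq_zero_of_forall_ne Y hY fun f hf => h0 f hf (by simp)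
    | insert e S heS ih =>
      intro Y hY h0 hYC hYg
      have h0' : Y e = 0 → ∀ f, f ≠ g → f ∉ S → Y f = 0 := fun hYe f hf hfS => by
        by_cases hfe : f = e
        · rw [hfe, hYe]
        · exact h0 f hf (by simp [hfe, hfS])
      by_cases heg : e = g
      · exact ih Y hY (fun f hf hfS => h0 f hf (by simp [heg, hf, hfS])) hYC hYg
      by_cases hYe : Y e = 0
      · exact ih Y hY (h0' hYe) hYC hYg
      exfalso
      obtain ⟨hCe, hCg, hCne, hC0⟩ := hC e (hB.2 ⟨heg, Y, hY, hYe⟩)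
      -- Eliminating against `-C e` removes `e` from the support and makes `g` negative; the
      -- induction hypothesis then gives `W = 0`, contradicting `W g = -1`.
      obtain ⟨W, hW, hWe, hW1, -⟩ := N.exists_elim_face (S := {e})
        (X := fun f => if f = g then -1 else C f f) hY (N.neg_mem _ hCe) hYe
        (by simpa using (hYC e heg).resolve_left hYe)
        (fun f hf => by
          by_cases hfg : f = g
          · simpa [hfg] using hYg
          · simpa [hfg] using hYC f hfg)
        (fun f hf => by
          by_cases hfg : f = g
          · simp [hfg, hCg]
          · simp [hC0 f hf hfg])
      have hWg : W g = -1 := by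
        rw [hW1 g (Ne.symm heg)]
        rcases hYg with h | h <;> simp [signComp, h, hCg]
      have hWf : ∀ f, f ≠ e → f ≠ g → W f = Y f := fun f hf hfg => by
        rw [hW1 f hf]
        simp +contextual [signComp, hC0 f hf hfg]
      have := ih W hW (fun f hf hfS => ?_) (fun f hf => ?_) (Or.inr hWg)
      · rw [this] at hWg
        exact absurd hWg (by simp)
      · by_cases hfe : f = e
        · rw [hfe, hWe]
        · rw [hWf f hfe hf]
          exact h0 f hf (by simp [hfe, hfS])
      · by_cases hfe : f = e
        · rw [hfe]; exact Or.inl hWe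
        · rw [hWf f hfe hf]; exact hYC f hf
  have hbdd : ∀ S ⊆ B, S.Nonempty → V S ∈ N.boundedComplex g := by
    intro S hSB hS
    refine ⟨hVmem S hSB hS, hVg S, fun Y hY hYV => ?_⟩
    rcases hYV g with h | h
    · refine Or.inl (hno Finset.univ Y hY (by simp) (fun f hf => ?_) (Or.inl h))
      have := hYV f
      rw [hVf S f hf] at this
      split_ifs at this with hfS
      · exact this
      · exact Or.inl (by simpa using this)
    · exact Or.inr (h.trans (hVg S))
  have hsurj : ∀ X ∈ N.boundedComplex g, ∃ S ⊆ B, S.Nonempty ∧ V S = X := by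
    intro X hX
    have hXg := hX.2.1
    have hXC : ∀ f, f ≠ g → X f = 0 ∨ X f = C f f := by
      intro e heg
      by_contra! h
      obtain ⟨hCe, hCg, hCne, hC0⟩ := hC e (hB.2 ⟨heg, X, hX.1, h.1⟩)
      have hXe : X e = - C e e := (SignType.eq_or_eq_neg h.1 hCne).resolve_left h.2
      -- `X` and `-C e` agree at `e` and are opposite at `g`, so elimination only erases `g`: a
      -- nonzero face of `X` vanishing at `g`.
      obtain ⟨W, hW, hWg, hW1, -⟩ := N.exists_elim_face (S := {g}) (X := X) (e := g) hX.1
        (N.neg_mem _ hCe) (by rw [hXg]; decide) (by simp [hXg, hCg])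
        (fun f _ => Or.inr rfl) (fun f hf => by
          by_cases hfe : f = e
          · subst hfe; exact Or.inr (by simp [hXe])
          · exact Or.inl (by simp [hC0 f hfe hf]))
      have hWX : ∀ f, f ≠ g → W f = X f := fun f hf => by
        rw [hW1 f hf]
        by_cases hfe : f = e
        · subst hfe; simp [signComp, hXe]
        · simp +contextual [signComp, hC0 f hfe hf]
      have hface : SignFace W X := fun f => by
        by_cases hf : f = g
        · rw [hf]; exact Or.inl hWg
        · exact Or.inr (hWX f hf)
      rcases hX.2.2 W hW hface with h' | h'
      · rw [← hWX e heg, h'] at h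
        exact h.1 rfl
      · rw [hWg] at h'; exact absurd h' (by decide)
    refine ⟨B.filter fun f => X f ≠ 0, Finset.filter_subset _ _, ?_, funext fun f => ?_⟩
    · by_contra hemp
      rw [Finset.not_nonempty_iff_eq_empty, Finset.filter_eq_empty_iff] at hemp
      have : X = 0 := hg.eq_zero_of_forall_ne X hX.1 fun f hf => by
        by_contra hXf
        exact hemp (hB.2 ⟨hf, X, hX.1, hXf⟩) hXf
      rw [this] at hXg
      exact absurd hXg (by simp)
    · by_cases hf : f = g
      · rw [hf, hVg, hXg]
      · rw [hVf _ f hf]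
        by_cases hXf : X f = 0
        · simp [hXf]
        · rw [if_pos (by simpa [hXf] using hB.2 ⟨hf, X, hX.1, hXf⟩)]
          exact ((hXC f hf).resolve_left hXf).symm
  have hzero : ∀ S ⊆ B, {f | V S f = 0} = {g}ᶜ \ (S : Set α) := by
    intro S hSB
    ext f
    by_cases hf : f = g
    · simp [hf, hVg]
    · by_cases hfS : f ∈ S
      · simp [hVf S f hf, hfS, (hC f (hSB hfS)).2.2.1]
      · simp [hVf S f hf, hfS, hf]
  have hsign : ∀ S ⊆ B, ε ({g}ᶜ \ (S : Set α)) = (-1) ^ S.card * ε {g}ᶜ := by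
    intro S
    induction S using Finset.induction_on with
    | empty => simp
    | insert e S heS ih =>
      intro hSB
      have heB := hSB (Finset.mem_insert_self e S)
      obtain ⟨hCe, hCg, hCne, hC0⟩ := hC e heB
      have h1 := hε.insert_eq_neg ({g}ᶜ \ ((insert e S : Finset α) : Set α)) (C e) hCe
        (fun a ha => hC0 a (fun h => ha.2 (by simp [h])) ha.1) e hCne
      have h2 : insert e ({g}ᶜ \ ((insert e S : Finset α) : Set α)) = {g}ᶜ \ (S : Set α) := by
        ext f
        by_cases hfe : f = e
        · simp [hfe, heS, (hB.1 heB).1]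
        · simp [hfe]
      rw [h2, ih ((Finset.subset_insert e S).trans hSB)] at h1
      rw [Finset.card_insert_of_notMem heS, pow_succ]
      linarith
  have hBne : B.Nonempty := by
    by_contra hemp
    obtain ⟨X, hX, hXg⟩ := hg.exists_ne_zero
    refine hXg (congrFun (hg.eq_zero_of_forall_ne X hX fun f hf => ?_) g)
    by_contra hXf
    exact hemp ⟨f, hB.2 ⟨hf, X, hX, hXf⟩⟩
  have hsum : N.boundedSum g ε = ∑ S ∈ B.powerset.erase ∅, (-1) ^ S.card * ε {g}ᶜ := by
    unfold boundedSum
    symm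
    refine Finset.sum_bij (fun S _ => V S) (fun S hS => ?_) (fun S hS T hT h => ?_)
      (fun X hX => ?_) fun S hS => ?_
    · rw [Finset.mem_erase, Finset.mem_powerset] at hS
      simpa using hbdd S hS.2 (Finset.nonempty_iff_ne_empty.2 hS.1)
    · rw [Finset.mem_erase, Finset.mem_powerset] at hS hT
      have h3 : {g}ᶜ \ (S : Set α) = {g}ᶜ \ (T : Set α) := by
        rw [← hzero S hS.2, ← hzero T hT.2]
        exact congrArg (fun X : α → SignType => {f | X f = 0}) h
      ext f
      by_cases hf : f = g
      · have h4 : ∀ S ⊆ B, f ∉ S := fun S hS hfS => (hB.1 (hS hfS)).1 hf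
        simp [h4 S hS.2, h4 T hT.2]
      · have := Set.ext_iff.1 h3 f
        simpa [hf, not_iff_not] using this
    · obtain ⟨S, hSB, hS, rfl⟩ := hsurj X (by simpa using hX)
      exact ⟨S, by simpa [hS.ne_empty] using hSB, rfl⟩
    · rw [Finset.mem_erase, Finset.mem_powerset] at hS
      rw [hzero S hS.2, hsign S hS.2]
  -- The alternating sum over all subsets is zero; without the empty set it is -1.
  have h0 := Finset.sum_powerset_neg_one_pow_card_of_nonempty hBne
  rw [← Finset.add_sum_erase _ _ (Finset.empty_mem_powerset B)] at h0
  rw [hsum, ← Finset.sum_mul]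
  rw [Finset.card_empty, pow_zero] at h0
  rw [show ∑ S ∈ B.powerset.erase ∅, (-1 : ℤ) ^ S.card = -1 by linarith]
  ring

open Classical in
/-- The Euler characteristic of the bounded complex with respect to a generic element. -/
theorem IsGenericElement.boundedSum_eq [Finite α] {N : OrientedMatroid α} {g : α}
    (hg : N.IsGenericElement g) {ε : Set α → ℤ} (hε : N.IsRankSign ε) :
    N.boundedSum g ε = - ε {g}ᶜ := by
  induction hn : {e | ∃ X ∈ N.covectors, X e ≠ 0}.ncard using Nat.strong_induction_on
    generalizing N ε with
  | _ n ih =>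
    by_cases hcol : ∀ e, e ≠ g → (∃ X ∈ N.covectors, X e ≠ 0) → ∃ X ∈ N.covectors, X ≠ 0 ∧
      ∀ f, f ≠ e → f ≠ g → X f = 0
    · exact hg.boundedSum_simplex hε hcol
    · push Not at hcol
      obtain ⟨e, heg, he, hnc⟩ := hcol
      have hnc' : ∀ X ∈ N.covectors, (∀ f, f ≠ e → f ≠ g → X f = 0) → X = 0 := by
        intro X hX h
        by_contra hX0
        obtain ⟨f, h1, h2, h3⟩ := hnc X hX hX0
        exact h3 (h f h1 h2)
      rw [← boundedSum_delete heg (fun X hX h => hnc' X hX fun f hf _ => h f hf) hε,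
        ih _ ?_ (hg.delete heg hnc') (hε.delete e) rfl]
      -- The elements other than `e` and `g` already span `e`, so removing `e` does not change the
      -- sign of `{g}ᶜ`.
      · have := hε.insert_eq ({g}ᶜ \ {e}) e fun X hX h =>
          congrFun (hnc' X hX fun f h1 h2 => h f ⟨h2, h1⟩) e
        rw [Set.insert_sdiff_singleton, Set.insert_eq_of_mem (by simpa using heg)] at this
        rw [this]
      · rw [← hn]
        refine Set.ncard_lt_ncard ⟨?_, fun h => ?_⟩
        · rintro f ⟨_, ⟨X, hX, rfl⟩, hXf⟩
          refine ⟨X, hX, fun h => hXf ?_⟩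
          by_cases hf : f = e <;> simp [hf, ← h]
        · obtain ⟨_, ⟨X, hX, rfl⟩, hXf⟩ := h he
          simp at hXf

end OrientedMatroid

/-! ### Möbius inversion and the number of bounded topes -/

lemma eq_mu_mul_of_sum_Ici_eq_zero {P : Type*} [PartialOrder P] [OrderTop P]
    [LocallyFiniteOrder P] [DecidableEq P] (f : P → ℤ)
    (h : ∀ x, x ≠ ⊤ → ∑ y ∈ Finset.Ici x, f y = 0) (x : P) :
    f x = IncidenceAlgebra.mu ℤ x ⊤ * f ⊤ := by
  rw [IncidenceAlgebra.moebius_inversion_top f (fun x => ∑ y ∈ Finset.Ici x, f y)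
    (fun _ => rfl) x, Finset.sum_eq_single ⊤]
  · simp
  · intro y _ hy
    rw [h y hy, mul_zero]
  · simp

namespace OrientedMatroid

variable {E : Type*}

lemma mem_ground_matroid [Finite E] (M : OrientedMatroid E) (e : E) : e ∈ M.matroid.E :=
  Set.mem_univ e

lemma isRankSign_eRk [Finite E] (M : OrientedMatroid E) :
    M.IsRankSign fun A => (-1) ^ (M.matroid.eRk A).toNat where
  insert_eq A e h := by
    rw [← M.matroid.eRk_closure_eq (insert e A),
      Matroid.closure_insert_eq_of_mem_closure ((M.mem_closure_matroid_iff A e).2 h),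
      Matroid.eRk_closure_eq]
  insert_eq_neg A X hX h0 e he := by
    rw [Matroid.eRk_insert_eq_add_one ⟨M.mem_ground_matroid e,
      fun h => he ((M.mem_closure_matroid_iff A e).1 h X hX h0)⟩,
      ENat.toNat_add (Matroid.isRkFinite_set _ _).eRk_lt_top.ne (by simp)]
    simp [pow_succ]

namespace IsGenericExtension

variable [Finite E] {M : OrientedMatroid E} {N : OrientedMatroid (Option E)}

lemma restrict_mem (hN : M.IsGenericExtension N) {X : Option E → SignType}
    (hX : X ∈ N.covectors) : (fun e => X (some e)) ∈ M.covectors := by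
  rw [hN.deletion]
  exact ⟨X, hX, rfl⟩

lemma exists_lift (hN : M.IsGenericExtension N) {X : E → SignType} (hX : X ∈ M.covectors) :
    ∃ Y ∈ N.covectors, ∀ e, Y (some e) = X e := by
  rw [hN.deletion] at hX
  obtain ⟨Y, hY, rfl⟩ := hX
  exact ⟨Y, hY, fun _ => rfl⟩

/-- A set of elements of `E` that spans `g` has full rank, so it spans `M`: covectors of `N`
vanishing on it vanish on `E`, and at `g` by assumption. -/
lemma isGenericElement (hN : M.IsGenericExtension N) : N.IsGenericElement none where
  exists_ne_zero := by
    by_contra! h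
    exact hN.not_isLoop ((N.mem_closure_matroid_iff ∅ none).2 fun X hX _ => h X hX)
  eq_zero_of_forall_ne X hX h := by
    have hcl : none ∈ N.matroid.closure (N.matroid.E \ {none}) := by
      by_contra hcl
      exact hN.not_isColoop ((Matroid.isColoop_iff_notMem_closure_compl
        (N.mem_ground_matroid none)).2 hcl)
    have := (N.mem_closure_matroid_iff _ none).1 hcl X hX fun a ha => h a ha.2
    funext e
    by_cases he : e = none
    · rw [he, this]; rfl
    · exact h e he
  transversal A hA h X hX hXA := by
    have hA' : some '' (some ⁻¹' A) = A := by
      rw [Set.image_preimage_eq_iff]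
      intro a ha
      cases a with
      | none => exact absurd ha hA
      | some e => exact ⟨e, rfl⟩
    have hcl : none ∈ N.matroid.closure (some '' (some ⁻¹' A)) := by
      rw [hA']
      exact (N.mem_closure_matroid_iff A none).2 h
    have hrk : M.matroid.eRank ≤ M.matroid.eRk (some ⁻¹' A) := by
      by_contra! hlt
      exact hN.generic _ hlt hcl
    have hsp := (Matroid.spanning_iff_eRk_le (M := M.matroid) (Set.subset_univ _)).2 hrk
    funext e
    cases e with
    | none => exact h X hX hXA
    | some e =>
      have : e ∈ M.matroid.closure (some ⁻¹' A) := by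
        rw [hsp.closure_eq]
        exact M.mem_ground_matroid e
      exact (M.mem_closure_matroid_iff _ e).1 this _ (hN.restrict_mem hX) fun a ha => hXA _ ha

lemma closure_zeroSet (hN : M.IsGenericExtension N) {X : Option E → SignType}
    (hX : X ∈ N.covectors) :
    M.matroid.closure {e | X (some e) = 0} = {e | X (some e) = 0} :=
  ((M.isFlat_matroid_iff _).2 ⟨_, hN.restrict_mem hX, rfl⟩).closure

lemma mem_boundedTopes_iff (hN : M.IsGenericExtension N) {X : Option E → SignType} :
    X ∈ N.boundedTopes none ↔ X ∈ N.boundedComplex none ∧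
      M.matroid.closure {e | X (some e) = 0} = M.matroid.closure ∅ := by
  rw [hN.isGenericElement.mem_boundedTopes_iff]
  refine and_congr_right fun hX => ?_
  rw [hN.closure_zeroSet hX.1]
  constructor
  · intro h
    refine Set.Subset.antisymm (fun e he => ?_) (fun e he => ?_)
    · refine (M.mem_closure_matroid_iff ∅ e).2 fun Y hY _ => ?_
      obtain ⟨Y', hY', h'⟩ := hN.exists_lift hY
      rw [← h' e]
      exact h _ he Y' hY'
    · exact (M.mem_closure_matroid_iff ∅ e).1 he _ (hN.restrict_mem hX.1) (by simp)
  · intro h e he Y hY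
    cases e with
    | none => rw [hX.2.1] at he; exact absurd he (by decide)
    | some e =>
      have : e ∈ M.matroid.closure ∅ := h ▸ he
      exact (M.mem_closure_matroid_iff ∅ e).1 this _ (hN.restrict_mem hY) (by simp)

lemma isTope (hN : M.IsGenericExtension N) {T : E → SignType} (hT : T ∈ N.boundedTopesDelete) :
    M.IsTope T := by
  obtain ⟨X, hX, rfl⟩ := hT
  rw [hN.isGenericElement.mem_boundedTopes_iff] at hX
  refine ⟨hN.restrict_mem hX.1.1, fun Y hY hXY => funext fun e => ?_⟩
  obtain ⟨Y', hY', h'⟩ := hN.exists_lift hY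
  rcases hXY e with h | h
  · rw [← h', hX.2 _ h Y' hY']; exact h.symm
  · exact h.symm

/-- The signed count of the bounded covectors vanishing on a proper flat. -/
lemma sum_boundedComplex_of_isFlat (hN : M.IsGenericExtension N) {F : Set E}
    (hF : M.matroid.IsFlat F) (hFE : F ≠ Set.univ) {ε : Set (Option E) → ℤ}
    (hε : N.IsRankSign ε) (s : Finset (Option E → SignType))
    (hs : ∀ X, X ∈ s ↔ X ∈ N.boundedComplex none ∧ ∀ e ∈ F, X (some e) = 0) :
    ∑ X ∈ s, ε {e | X e = 0} = - ε {none}ᶜ := by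
  obtain ⟨P, hP, rfl⟩ := (M.isFlat_matroid_iff F).1 hF
  obtain ⟨P', hP', hPP'⟩ := hN.exists_lift hP
  have hP0 : P' ≠ 0 := by
    rintro rfl
    exact hFE (Set.eq_univ_of_forall fun e => (hPP' e).symm)
  -- Contracting the flat selects the bounded covectors vanishing on it; properness supplies the
  -- nonzero covector that keeps `none` generic.
  have h := (hN.isGenericElement.contract (F := some '' {e | P e = 0}) (by simp) hP' hP0
    (by rintro _ ⟨e, he, rfl⟩; rw [hPP' e]; exact he)).boundedSum_eq (hε.contract _)
  have hcompl : ({none}ᶜ : Set (Option E)) ∪ some '' {e | P e = 0} = {none}ᶜ :=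
    Set.union_eq_left.2 (by rintro _ ⟨e, -, rfl⟩; simp)
  rw [hcompl] at h
  rw [← h, boundedSum]
  have hs' : s = (Set.toFinite ((N.contract (some '' {e | P e = 0})).boundedComplex
      none)).toFinset := by
    ext X
    simp [hs, mem_boundedComplex_contract]
  rw [← hs']
  refine Finset.sum_congr rfl fun X hX => ?_
  congr 1
  symm
  rw [Set.union_eq_left]
  rintro _ ⟨e, he, rfl⟩
  exact ((hs X).1 hX).2 e he

end IsGenericExtension

open Classical in
lemma IsGenericExtension.ncard_boundedTopesDelete [Fintype E] {M : OrientedMatroid E}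
    {N : OrientedMatroid (Option E)} (hN : M.IsGenericExtension N) :
    N.boundedTopesDelete.ncard = M.matroid.mobiusNumber.natAbs := by
  let P := {F : Set E // M.matroid.IsFlat F}
  let _ : LocallyFiniteOrder P := Fintype.toLocallyFiniteOrder
  let _ : OrderTop P :=
    { top := ⟨M.matroid.E, M.matroid.ground_isFlat⟩, le_top := fun F => F.2.subset_ground }
  let ε : Set (Option E) → ℤ := fun A => (-1) ^ (N.matroid.eRk A).toNat
  have hε : N.IsRankSign ε := N.isRankSign_eRk
  have hε1 : ∀ A, (ε A).natAbs = 1 := fun A => by simp [ε, Int.natAbs_pow]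
  let b := (Set.toFinite (N.boundedComplex none)).toFinset
  have hb : ∀ {X}, X ∈ b ↔ X ∈ N.boundedComplex none := fun {X} => by simp [b]
  -- The closure only makes `z` total: on bounded covectors the zero set is already a flat.
  let z : (Option E → SignType) → P := fun X =>
    ⟨M.matroid.closure {e | X (some e) = 0}, M.matroid.isFlat_closure _⟩
  have hz : ∀ {X}, X ∈ b → (z X : Set E) = {e | X (some e) = 0} := fun hX =>
    hN.closure_zeroSet (hb.1 hX).1
  have hztop : ∀ {X}, X ∈ b → z X ≠ ⊤ := by
    intro X hX h
    have h1 : {e | X (some e) = 0} = Set.univ := (hz hX).symm.trans (congrArg Subtype.val h)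
    have h2 : X = 0 := hN.isGenericElement.eq_zero_of_forall_ne X (hb.1 hX).1 fun e he => by
      cases e with
      | none => exact absurd rfl he
      | some e => exact Set.eq_univ_iff_forall.1 h1 e
    have := (hb.1 hX).2.1
    rw [h2] at this
    exact absurd this (by simp)
  -- No bounded covector vanishes on all of `E`, so the top carries only the correction term, chosen
  -- to cancel the Euler characteristic over each proper flat.
  let f : P → ℤ := fun F => (if F = ⊤ then ε {none}ᶜ else 0) +
    ∑ X ∈ b with z X = F, ε {e | X e = 0}
  have hftop : f ⊤ = ε {none}ᶜ := by
    simp only [f, if_true, add_eq_left]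
    refine Finset.sum_eq_zero fun X hX => ?_
    rw [Finset.mem_filter] at hX
    exact absurd hX.2 (hztop hX.1)
  have hsum : ∀ F, F ≠ ⊤ → ∑ G ∈ Finset.Ici F, f G = 0 := by
    intro F hF
    have h1 : ∑ G ∈ Finset.Ici F, ∑ X ∈ b with z X = G, ε {e | X e = 0} =
        ∑ X ∈ b with F ≤ z X, ε {e | X e = 0} := by
      rw [← Finset.sum_fiberwise_of_maps_to (s := b.filter fun X => F ≤ z X)
        (t := Finset.Ici F) (g := z) (fun X hX => by simpa using (Finset.mem_filter.1 hX).2)]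
      refine Finset.sum_congr rfl fun G hG => Finset.sum_congr ?_ fun _ _ => rfl
      ext X
      simp only [Finset.mem_filter]
      constructor
      · rintro ⟨h1, rfl⟩
        exact ⟨⟨h1, by simpa using hG⟩, rfl⟩
      · rintro ⟨⟨h1, -⟩, h2⟩
        exact ⟨h1, h2⟩
    have h2 : ∑ G ∈ Finset.Ici F, (if G = ⊤ then ε {none}ᶜ else 0) = ε {none}ᶜ := by
      rw [Finset.sum_ite_eq', if_pos (Finset.mem_Ici.2 le_top)]
    rw [Finset.sum_add_distrib, h1, h2, hN.sum_boundedComplex_of_isFlat F.2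
      (fun h => hF (Subtype.ext h)) hε _ fun X => ?_]
    · exact add_neg_cancel _
    · rw [Finset.mem_filter, ← hb]
      refine and_congr_right fun hX => ?_
      rw [← Subtype.coe_le_coe, hz hX]
      rfl
  let F₀ : P := ⟨M.matroid.closure ∅, M.matroid.isFlat_closure ∅⟩
  have hF₀ : F₀ ≠ ⊤ := by
    intro h
    obtain ⟨X, hX, hXg⟩ := hN.isGenericElement.exists_ne_zero
    refine hXg (congrFun (hN.isGenericElement.eq_zero_of_forall_ne X hX fun e he => ?_) none)
    cases e with
    | none => exact absurd rfl he
    | some e =>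
      have : e ∈ M.matroid.closure ∅ := (congrArg Subtype.val h).ge (M.mem_ground_matroid e)
      exact (M.mem_closure_matroid_iff ∅ e).1 this _ (hN.restrict_mem hX) (by simp)
  have hfF₀ : f F₀ = (b.filter fun X => z X = F₀).card * ε (some '' M.matroid.closure ∅) := by
    simp only [f, if_neg hF₀, zero_add]
    rw [Finset.sum_congr rfl fun X hX => ?_, Finset.sum_const, nsmul_eq_mul]
    rw [Finset.mem_filter] at hX
    congr 1
    have h1 : {e | X (some e) = 0} = M.matroid.closure ∅ :=
      (hz hX.1).symm.trans (congrArg Subtype.val hX.2)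
    rw [← h1]
    ext e
    cases e with
    | none => simp [(hb.1 hX.1).2.1]
    | some e => simp
  have hcard : N.boundedTopesDelete.ncard = (b.filter fun X => z X = F₀).card := by
    rw [boundedTopesDelete, Set.InjOn.ncard_image, ← Set.ncard_coe_finset]
    · congr 1
      ext X
      rw [hN.mem_boundedTopes_iff]
      rw [Finset.mem_coe, Finset.mem_filter, hb]
      exact and_congr_right fun _ =>
        (Subtype.ext_iff (a1 := z X) (a2 := F₀)).symm
    -- All bounded covectors are positive at `none`, so deleting it loses nothing.
    · intro X hX Y hY h
      funext e
      cases e with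
      | none => rw [hX.1.2.1, hY.1.2.1]
      | some e => exact congrFun h e
  have hmain := congrArg Int.natAbs (eq_mu_mul_of_sum_Ici_eq_zero f hsum F₀)
  rw [hfF₀, hftop, Int.natAbs_mul, Int.natAbs_mul, hε1, hε1, mul_one, mul_one,
    Int.natAbs_natCast] at hmain
  rw [hcard, hmain]
  rfl

end OrientedMatroid

/-! ### Bases of minimum weight -/

open Classical in
lemma setWeight_insert_sdiff_singleton {E : Type*} [Fintype E] (ω : E → ℝ) {B : Set E} {e f : E}
    (he : e ∈ B) (hf : f ∉ B) :
    setWeight ω (insert f (B \ {e})) = setWeight ω B - ω e + ω f := by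
  have h1 : (insert f (B \ {e})).toFinset = insert f (B.toFinset.erase e) := by
    ext a; simp [and_comm]
  have h2 : f ∉ B.toFinset.erase e := by simp [hf]
  unfold setWeight
  have h3 := Finset.add_sum_erase B.toFinset ω (Set.mem_toFinset.2 he)
  calc _ = ∑ a ∈ insert f (B.toFinset.erase e), ω a := by
        refine Finset.sum_congr ?_ fun _ _ => rfl
        rw [← h1]
        ext; simp
    _ = _ := by rw [Finset.sum_insert h2]; linarith

lemma Matroid.exists_isMinWeightBase {E : Type*} [Fintype E] (U : Matroid E) (ω : E → ℝ) :
    ∃ B, U.IsMinWeightBase ω B := by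
  obtain ⟨B, hB, hmin⟩ := (Set.toFinite {B | U.IsBase B}).exists_minimalFor (setWeight ω) _
    U.exists_isBase
  refine ⟨B, hB, fun C hC => ?_⟩
  rcases le_total (setWeight ω B) (setWeight ω C) with h | h
  · exact h
  · exact hmin hC h

/-- An element lies in a basis of minimum weight if and only if it is not spanned by the elements
of smaller weight. -/
lemma Matroid.exists_isMinWeightBase_mem_iff {E : Type*} [Fintype E] (U : Matroid E) (ω : E → ℝ)
    {e : E} (heE : e ∈ U.E) :
    (∃ B, U.IsMinWeightBase ω B ∧ e ∈ B) ↔ e ∉ U.closure {f | ω f < ω e} := by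
  constructor
  · rintro ⟨B, ⟨hB, hmin⟩, heB⟩ hcl
    have heB' : e ∉ U.closure (B \ {e}) := hB.indep.notMem_closure_sdiff_of_mem heB
    have : ∃ f ∈ U.E, ω f < ω e ∧ f ∉ U.closure (B \ {e}) := by
      by_contra! h
      refine heB' ?_
      rw [← U.closure_inter_ground] at hcl
      exact U.closure_subset_closure_of_subset_closure (fun f hf => h f hf.2 hf.1) hcl
    obtain ⟨f, hfE, hlt, hf⟩ := this
    have hfB : f ∉ B := fun hfB => hf (U.mem_closure_of_mem' ⟨hfB, by
      rintro rfl; exact lt_irrefl _ hlt⟩)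
    have h1 := hmin _ (hB.exchange_base_of_notMem_closure heB hf)
    rw [setWeight_insert_sdiff_singleton ω heB hfB] at h1
    linarith
  · intro hcl
    obtain ⟨B, hB, hmin⟩ := U.exists_isMinWeightBase ω
    by_cases heB : e ∈ B
    · exact ⟨B, ⟨hB, hmin⟩, heB⟩
    -- The light part of `B` together with `e` extends inside `B ∪ {e}` to a basis `B'`. Exchanging
    -- some `f ∈ B` missing from `B'` must bring in `e`; as the light part is kept, `f` weighs at
    -- least as much as `e`.
    have hI : U.Indep (insert e (B ∩ {f | ω f < ω e})) := by
      rw [(hB.indep.inter_right _).insert_indep_iff]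
      exact Or.inl ⟨heE, fun h => hcl (U.closure_subset_closure Set.inter_subset_right h)⟩
    obtain ⟨B', hB', hIB', hB'I⟩ := hI.exists_isBase_subset_union_isBase hB
    have heB' : e ∈ B' := hIB' (Set.mem_insert e _)
    obtain ⟨f, hfB, hfB'⟩ : ∃ f ∈ B, f ∉ B' := by
      by_contra! h
      exact heB ((hB.eq_of_subset_isBase hB' h).symm ▸ heB')
    obtain ⟨y, ⟨hyB', hyB⟩, hbase⟩ := hB.exchange_mem hB' hfB hfB'
    have hye : y = e := by
      rcases hB'I hyB' with (h | h) | h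
      · exact h
      · exact absurd h.1 hyB
      · exact absurd h hyB
    subst hye
    refine ⟨_, ⟨hbase, fun C hC => ?_⟩, Set.mem_insert y _⟩
    have hle : ω y ≤ ω f := by
      by_contra! hlt
      exact hfB' (hIB' (Set.mem_insert_of_mem _ ⟨hfB, hlt⟩))
    rw [setWeight_insert_sdiff_singleton ω hfB hyB]
    linarith [hmin C hC]

/-! ### Covering the Bergman complex -/

namespace OrientedMatroid

variable {E : Type*}

lemma mem_bergman_iff [Fintype E] (M : OrientedMatroid E) (ω : E → ℝ) :
    ω ∈ M.matroid.bergman ↔ ω ∈ weightSphere E ∧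
      ∀ e, ∃ X ∈ M.covectors, (∀ f, ω f < ω e → X f = 0) ∧ X e ≠ 0 := by
  refine and_congr_right fun _ => forall_congr' fun e => ?_
  rw [Matroid.exists_isMinWeightBase_mem_iff _ _ (M.mem_ground_matroid e),
    mem_closure_matroid_iff]
  push Not
  rfl

lemma mem_positiveBergman_reorient_iff [Fintype E] (M : OrientedMatroid E) {T : E → SignType}
    (hT : ∀ e, T e ≠ 0) (ω : E → ℝ) :
    ω ∈ (M.reorient {e | T e = -1}).positiveBergman ↔ ω ∈ weightSphere E ∧
      ∀ c, ∃ X ∈ M.covectors, (∀ e, ω e < c → X e = 0) ∧ ∀ e, ω e = c → X e = T e := by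
  refine and_congr_right fun _ => forall_congr' fun c => ?_
  have hflip : ∀ (X : E → SignType) e, signFlip {e | T e = -1} X e = 0 ↔ X e = 0 := fun X e => by
    by_cases h : T e = -1 <;> simp [signFlip, h]
  have hone : ∀ (X : E → SignType) e, signFlip {e | T e = -1} X e = 1 ↔ X e = T e := by
    intro X e
    by_cases h : T e = -1
    · simp [signFlip, h, neg_eq_iff_eq_neg]
    · have h1 : T e = 1 := by simpa [h] using SignType.eq_or_eq_neg (hT e) (b := 1) (by decide)
      simp [signFlip, h1]
  constructor
  · rintro ⟨X, hX, h1, h2⟩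
    refine ⟨_, hX, fun e he => (hflip X e).2 (h1 e he), fun e he => ?_⟩
    rw [← hone, signFlip_signFlip]
    exact (h2 e he).symm
  · rintro ⟨X, hX, h1, h2⟩
    refine ⟨signFlip {e | T e = -1} X, ?_, fun e he => (hflip X e).2 (h1 e he),
      fun e he => ((hone X e).2 (h2 e he)).symm⟩
    change signFlip _ (signFlip _ X) ∈ M.covectors
    rwa [signFlip_signFlip]

/-- The sublevel sets of a weight in the Bergman complex are flats. -/
lemma exists_zeroSet_eq_sublevel [Finite E] (M : OrientedMatroid E) {ω : E → ℝ}
    (h : ∀ e, ∃ X ∈ M.covectors, (∀ f, ω f < ω e → X f = 0) ∧ X e ≠ 0) (c : ℝ) :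
    ∃ X ∈ M.covectors, ∀ e, X e = 0 ↔ ω e < c := by
  have hF : M.matroid.IsFlat {e | ω e < c} := by
    rw [Matroid.isFlat_iff_closure_eq]
    refine Set.Subset.antisymm (fun e he => ?_) (M.matroid.subset_closure _ (Set.subset_univ _))
    by_contra hlt
    obtain ⟨X, hX, h0, hXe⟩ := h e
    exact hXe ((M.mem_closure_matroid_iff _ e).1 he X hX fun f hf =>
      h0 f (lt_of_lt_of_le hf (not_lt.1 hlt)))
  obtain ⟨X, hX, hXF⟩ := (M.isFlat_matroid_iff _).1 hF
  exact ⟨X, hX, fun e => (Set.ext_iff.1 hXF e).symm⟩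

/-- Every flag of flats, given by the sublevel sets of a weight, is the flag of zero sets of faces
of a bounded covector. -/
lemma IsGenericExtension.exists_boundedComplex_of_flag [Finite E] {M : OrientedMatroid E}
    {N : OrientedMatroid (Option E)} (hN : M.IsGenericExtension N) {ω : E → ℝ} {e₀ : E}
    (hflat : ∀ c, ∃ X ∈ M.covectors, ∀ e, X e = 0 ↔ ω e < c)
    (s : Finset ℝ) (hs : ∀ c ∈ s, c ≤ ω e₀) :
    ∃ T ∈ N.boundedComplex none,
      (∀ c ≤ ω e₀, (∀ d ∈ s, c ≤ d) → ∀ e, ω e < c → T (some e) = 0) ∧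
      ∀ c ∈ s, ∃ X ∈ N.covectors, SignFace X T ∧ ∀ e, X (some e) = 0 ↔ ω e < c := by
  have hg := hN.isGenericElement
  have hflat' : ∀ c, ∃ X ∈ N.covectors, ∀ e, X (some e) = 0 ↔ ω e < c := by
    intro c
    obtain ⟨X, hX, hXc⟩ := hflat c
    obtain ⟨Y, hY, hYX⟩ := hN.exists_lift hX
    exact ⟨Y, hY, fun e => by rw [hYX, hXc]⟩
  -- Levels enter in decreasing order, so the flats shrink and each new covector extends the
  -- previous one. The second conclusion records that `T` still vanishes on every later flat.
  induction s using Finset.induction_on_min with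
  | empty =>
    -- `P` is nonzero because it does not vanish at `e₀`, which is not lighter than itself.
    obtain ⟨P, hP, hP0⟩ := hflat' (ω e₀)
    obtain ⟨T, hT, hPT⟩ := hg.exists_mem_boundedComplex hP fun h =>
      lt_irrefl (ω e₀) ((hP0 e₀).1 (congrFun h _))
    refine ⟨T, hT, fun c hc _ e he => ?_, by simp⟩
    exact (hPT (show some e ∈ zeroSetOff none P from
      ⟨by simp, (hP0 e).2 (he.trans_le hc)⟩)).2
  | insert c s hcs ih =>
    obtain ⟨T, hT, hT0, hTs⟩ := ih fun d hd => hs d (Finset.mem_insert_of_mem hd)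
    obtain ⟨P, hP, hPc⟩ := hflat' c
    obtain ⟨T', hT', hTT', hT'0⟩ := hg.exists_boundedComplex_extend hT hP
    have hzero : ∀ e, T' (some e) = 0 ↔ ω e < c := fun e => by
      rw [hT'0, hPc]
      exact ⟨fun h => h.2, fun h => ⟨hT0 c (hs c (Finset.mem_insert_self c s))
        (fun d hd => (hcs d hd).le) e h, h⟩⟩
    refine ⟨T', hT', fun d _ hds e he =>
      (hzero e).2 (he.trans_le (hds c (Finset.mem_insert_self c s))), fun d hd => ?_⟩
    rcases Finset.mem_insert.1 hd with rfl | hd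
    · exact ⟨T', hT'.1, fun _ => Or.inr rfl, hzero⟩
    · obtain ⟨X, hX, hXT, hX0⟩ := hTs d hd
      exact ⟨X, hX, hXT.trans hTT', hX0⟩

/-- For any `T`, acyclicity of the reoriented initial matroid gives at each level a covector nonzero
on the whole level, hence no loops. Conversely, the lifted flag gives a bounded `T` whose faces
restrict to `T` on each level. -/
lemma IsGenericExtension.iUnion_positiveBergman [Fintype E] {M : OrientedMatroid E}
    {N : OrientedMatroid (Option E)} (hN : M.IsGenericExtension N) :
    (⋃ T ∈ N.boundedTopesDelete, (M.reorient {e | T e = -1}).positiveBergman) =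
      M.matroid.bergman := by
  classical
  ext ω
  simp only [Set.mem_iUnion, exists_prop]
  constructor
  · rintro ⟨T, -, hω, hac⟩
    refine (M.mem_bergman_iff ω).2 ⟨hω, fun e => ?_⟩
    obtain ⟨X, hX, h0, h1⟩ := hac (ω e)
    refine ⟨_, hX, fun f hf => by simp [signFlip, h0 f hf], ?_⟩
    simp only [signFlip, ← h1 e rfl]
    split_ifs <;> decide
  · intro hω
    obtain ⟨hS, hne⟩ := (M.mem_bergman_iff ω).1 hω
    have : Nonempty E := by
      by_contra hE
      rw [not_nonempty_iff] at hE
      have := hS.2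
      simp at this
    obtain ⟨e₀, h₀⟩ := Finite.exists_max ω
    obtain ⟨T, hT, -, hTs⟩ := hN.exists_boundedComplex_of_flag (e₀ := e₀)
      (M.exists_zeroSet_eq_sublevel hne)
      (Finset.univ.image ω) (by simpa using h₀)
    have hface : ∀ e, ∃ X ∈ N.covectors, (∀ f, ω f < ω e → X (some f) = 0) ∧
        ∀ f, ω f = ω e → X (some f) ≠ 0 ∧ X (some f) = T (some f) := by
      intro e
      obtain ⟨X, hX, hXT, hX0⟩ := hTs (ω e) (by simp)
      refine ⟨X, hX, fun f => (hX0 f).2, fun f hf => ?_⟩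
      have h : X (some f) ≠ 0 := fun h => absurd ((hX0 f).1 h) (by simp [hf])
      exact ⟨h, (hXT _).resolve_left h⟩
    -- The face at the level of `e` is nonzero at `e`, so `T` vanishes nowhere and is a bounded
    -- tope.
    have hT0 : ∀ e, T (some e) ≠ 0 := fun e => by
      obtain ⟨X, -, -, h⟩ := hface e
      rw [← (h e rfl).2]
      exact (h e rfl).1
    refine ⟨fun e => T (some e), ⟨T, hN.isGenericElement.mem_boundedTopes_iff.2 ⟨hT, ?_⟩, rfl⟩, ?_⟩
    · rintro (_ | e) he
      · rw [hT.2.1] at he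
        exact absurd he (by decide)
      · exact absurd he (hT0 e)
    · refine (M.mem_positiveBergman_reorient_iff hT0 ω).2 ⟨hS, fun c => ?_⟩
      by_cases hc : ∃ e, ω e = c
      · obtain ⟨e, rfl⟩ := hc
        obtain ⟨X, hX, h0, h1⟩ := hface e
        exact ⟨_, hN.restrict_mem hX, h0, fun f hf => (h1 f hf).2⟩
      · exact ⟨0, M.zero_mem, fun _ _ => rfl, fun e he => absurd ⟨e, he⟩ hc⟩

end OrientedMatroid

theorem mainTheorem3 {E : Type*} [Fintype E] (M : OrientedMatroid E)
    (N : OrientedMatroid (Option E)) (hN : M.IsGenericExtension N) :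
    (∀ T ∈ N.boundedTopesDelete, M.IsTope T) ∧
    N.boundedTopesDelete.ncard = M.matroid.mobiusNumber.natAbs ∧
    (⋃ T ∈ N.boundedTopesDelete, (M.reorient {e | T e = -1}).positiveBergman) =
      M.matroid.bergman :=
  ⟨fun _ => hN.isTope, hN.ncard_boundedTopesDelete, hN.iUnion_positiveBergman⟩
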